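/- Let $0\le k\le n$ and let $\Omega\subset\mathbb{R}^n$ be a generalized polytope, that is, $$\Omega=\Omega_0\setminus\bigcup_{i=1}^{M}\overline{\Omega}_i ,$$ where $M\ge 0$ and $\Omega_0,\Omega_1,\dots,\Omega_M$ are bounded open polytopes such that $\overline{\Omega}_i\subset\Omega_0$ and $\overline{\Omega}_i\cap\overline{\Omega}_j=\emptyset$ for all $i,j\in\{1,\dots,M\}$, $i\ne j$. Here a bounded open polytope (convex or not) is the interior of a finite union of closed convex polytopes, a closed convex polytope being a bounded intersection of finitely many closed half-spaces. Let $\omega=\sum_{i_1<\cdots<i_k}\omega^{i_1\cdots i_k}\,dx^{i_1}\wedge\cdots\wedge dx^{i_k}$ be a $k$-form of class $C^1(\overline{\Omega})$ (continuous on $\overline\Omega$, differentiable in $\Omega$, with first derivatives that extend continuously to $\overline\Omega$). Let $\nu$ be the outward unit normal to $\partial\Omega$, which is defined on the relative interiors of the faces, and suppose that $$\text{either}\quad \nu\wedge\omega=0 \text{ on } \partial\Omega \qquad\text{or}\qquad \nu\,\lrcorner\,\omega=0 \text{ on } \partial\Omega ,$$ wherever $\nu$ is defined, where $(\nu\,\lrcorner\,\omega)^{i_1\cdots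 i_{k-1}}=\sum_{j}\nu^{j}\omega^{j i_1\cdots i_{k-1}}$. Then $|\nabla\omega|^2$, $|d\omega|^2$ and $|\delta\omega|^2$ are integrable on $\Omega$ and $$\int_\Omega|\nabla\omega|^2\,dx=\int_\Omega|d\omega|^2\,dx+\int_\Omega|\delta\omega|^2\,dx .$$ Here $d$ is the exterior derivative, $\delta\omega$ is the $(k-1)$-form with components $(\delta\omega)^{i_1\cdots i_{k-1}}=\sum_{j=1}^n\partial\omega^{j i_1\cdots i_{k-1}}/\partial x_j$ (for $k=0$ one sets $\delta\omega=0$ and $\nu\,\lrcorner\,\omega=0$), $|\alpha|^2=\sum_{i_1<\cdots<i_m}(\alpha^{i_1\cdots i_m})^2$ for an $m$-form $\alpha$, and $|\nabla\omega|^2=\sum_{j=1}^n|\partial\omega/\partial x_j|^2$. -/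

import Mathlib

open MeasureTheory

noncomputable section

/-- `Λᵏ(ℝⁿ)`: a `k`-form with constant coefficients is a continuous alternating
`k`-linear map on `ℝⁿ`; its components are its values on the standard basis vectors. -/
abbrev KForm (n k : ℕ) : Type :=
  EuclideanSpace ℝ (Fin n) [⋀^Fin k]→L[ℝ] ℝ

namespace KForm

variable {n : ℕ}

/-- The `j`-th standard basis vector of `ℝⁿ`. -/
abbrev basisVec (j : Fin n) : EuclideanSpace ℝ (Fin n) :=
  EuclideanSpace.single j 1

/-- The component `ω^{i₁ ⋯ iₖ} = ω(e_{i₁}, …, e_{iₖ})`. -/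
def component {k : ℕ} (ω : KForm n k) (I : Fin k → Fin n) : ℝ :=
  ω (fun a => basisVec (I a))

/-- `|ω|² = ∑_{i₁ < ⋯ < iₖ} (ω^{i₁ ⋯ iₖ})²`: the sum runs over the strictly increasing maps
`Fin k → Fin n`. (This is not the operator norm of Mathlib.) -/
def normSq {k : ℕ} (ω : KForm n k) : ℝ :=
  ∑ I : Fin k ↪o Fin n, ω.component I ^ 2

/-- The exterior product `ν ∧ ω` of the `1`-form `∑ νʲ dxʲ` with a `k`-form, that is
`(ν ∧ ω)(v₀, …, vₖ) = ∑ᵢ (-1)ⁱ ⟨ν, vᵢ⟩ ω(v₀, …, v̂ᵢ, …, vₖ)`. -/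
def wedge {k : ℕ} (ν : EuclideanSpace ℝ (Fin n)) (ω : KForm n k) : KForm n (k + 1) :=
  ContinuousAlternatingMap.alternatizeUncurryFin ((innerSL ℝ ν).smulRight ω)

/-- The interior product `ν ⌟ ω = ω(ν, ·, …, ·)`; it is `0` on `0`-forms. -/
def interiorProd : {k : ℕ} → EuclideanSpace ℝ (Fin n) → KForm n k → KForm n (k - 1)
  | 0, _, _ => 0
  | _ + 1, ν, ω => ω.curryLeft ν

/-- The partial derivative `∂ω/∂xⱼ` of a differential form. -/
def partialDeriv {k : ℕ} (ω : EuclideanSpace ℝ (Fin n) → KForm n k) (j : Fin n)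
    (x : EuclideanSpace ℝ (Fin n)) : KForm n k :=
  fderiv ℝ ω x (basisVec j)

/-- `|∇ω|² = ∑ⱼ |∂ω/∂xⱼ|²`, the sum of the squares of all first partial derivatives of the
components `ω^{i₁ ⋯ iₖ}`, `i₁ < ⋯ < iₖ`. -/
def gradNormSq {k : ℕ} (ω : EuclideanSpace ℝ (Fin n) → KForm n k)
    (x : EuclideanSpace ℝ (Fin n)) : ℝ :=
  ∑ j : Fin n, (partialDeriv ω j x).normSq

/-- The codifferential `δω`, with components
`(δω)^{i₁ ⋯ iₖ₋₁} = ∑ⱼ ∂ω^{j i₁ ⋯ iₖ₋₁}/∂xⱼ`; it is `0` on `0`-forms. -/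
def codiff {k : ℕ} (ω : EuclideanSpace ℝ (Fin n) → KForm n k)
    (x : EuclideanSpace ℝ (Fin n)) : KForm n (k - 1) :=
  ∑ j : Fin n, interiorProd (basisVec j) (partialDeriv ω j x)

/-- `ω ∈ C¹(Ω̄; Λᵏ)`: `ω` is continuous on `Ω̄`, differentiable in the open set `Ω`, and its first
derivatives extend continuously from `Ω` to `Ω̄`. -/
def IsC1UpToBoundary {k : ℕ} (Ω : Set (EuclideanSpace ℝ (Fin n)))
    (ω : EuclideanSpace ℝ (Fin n) → KForm n k) : Prop :=
  ContinuousOn ω (closure Ω) ∧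
    ∃ D : EuclideanSpace ℝ (Fin n) → EuclideanSpace ℝ (Fin n) →L[ℝ] KForm n k,
      ContinuousOn D (closure Ω) ∧ ∀ x ∈ Ω, HasFDerivAt ω (D x) x

end KForm

namespace Polytopes

variable {n : ℕ}

/-- A (closed) convex polytope: a bounded intersection of finitely many closed half-spaces
`{x | ⟨a, x⟩ ≤ b}`. -/
def IsConvexPolytope (P : Set (EuclideanSpace ℝ (Fin n))) : Prop :=
  Bornology.IsBounded P ∧
    ∃ s : Finset (EuclideanSpace ℝ (Fin n) × ℝ), P = {x | ∀ h ∈ s, inner ℝ h.1 x ≤ h.2}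

/-- A bounded open polytope, convex or not: the interior of a finite union of closed convex
polytopes. -/
def IsOpenPolytope (U : Set (EuclideanSpace ℝ (Fin n))) : Prop :=
  ∃ S : Set (Set (EuclideanSpace ℝ (Fin n))),
    S.Finite ∧ (∀ P ∈ S, IsConvexPolytope P) ∧ U = interior (⋃₀ S)

/-- A generalized polytope: `Ω = Ω₀ \ (Ω̄₁ ∪ ⋯ ∪ Ω̄_M)` with bounded open polytopes
`Ω₀, Ω₁, …, Ω_M` such that the closures of the holes `Ω₁, …, Ω_M` lie in `Ω₀` and are pairwise
disjoint; here `H i` is the `i`-th hole, and `M = 0` is allowed. -/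
def IsGeneralizedPolytope (Ω : Set (EuclideanSpace ℝ (Fin n))) : Prop :=
  ∃ (Ω₀ : Set (EuclideanSpace ℝ (Fin n))) (M : ℕ) (H : Fin M → Set (EuclideanSpace ℝ (Fin n))),
    IsOpenPolytope Ω₀ ∧ (∀ i, IsOpenPolytope (H i)) ∧
    (∀ i, closure (H i) ⊆ Ω₀) ∧
    (∀ i j, i ≠ j → closure (H i) ∩ closure (H j) = ∅) ∧
    Ω = Ω₀ \ ⋃ i, closure (H i)

/-- `ν` is the outward unit normal to `∂Ω` at `x`: near `x` the set `Ω` is the open half-ball on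
the side of `-ν`. The boundary of a generalized polytope is flat near each point of the relative
interior of a face, and these are exactly the boundary points (almost all of them for the surface
measure) that have a normal; at edges and vertices there is none. -/
def IsOutwardUnitNormal (Ω : Set (EuclideanSpace ℝ (Fin n))) (x ν : EuclideanSpace ℝ (Fin n)) :
    Prop :=
  ‖ν‖ = 1 ∧ ∃ r > 0, ∀ y ∈ Metric.ball x r, y ∈ Ω ↔ inner ℝ ν (y - x) < 0

/-- `ν ∧ ω = 0` on `∂Ω`, i.e. wherever the normal is defined. -/
def TangentialPartVanishes {k : ℕ} (Ω : Set (EuclideanSpace ℝ (Fin n)))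
    (ω : EuclideanSpace ℝ (Fin n) → KForm n k) : Prop :=
  ∀ x ∈ frontier Ω, ∀ ν, IsOutwardUnitNormal Ω x ν → KForm.wedge ν (ω x) = 0

/-- `ν ⌟ ω = 0` on `∂Ω`, i.e. wherever the normal is defined. -/
def NormalPartVanishes {k : ℕ} (Ω : Set (EuclideanSpace ℝ (Fin n)))
    (ω : EuclideanSpace ℝ (Fin n) → KForm n k) : Prop :=
  ∀ x ∈ frontier Ω, ∀ ν, IsOutwardUnitNormal Ω x ν → KForm.interiorProd ν (ω x) = 0

end Polytopes

end

/-! Write `ω_i` for the interior product of `ω` with the `i`-th basis vector. Since `dω = ∑ e_j ∧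
∂_j ω`, the adjointness of exterior and interior product (`ip_wedge_left`) and their anticommutation
(`curryLeft_wedge`) give, in positive degree, the pointwise identity `|dω|² + |δω|² - |∇ω|² =
∑_{i,j} (⟨∂_i ω_i, ∂_j ω_j⟩ - ⟨∂_i ω_j, ∂_j ω_i⟩)`. The right-hand side, `gaffneyDefect`, is a sum
of 2×2 Jacobians, hence formally a divergence, and the task is to show that its integral vanishes.

No divergence theorem on polytopes is used. The boundary lies in finitely many hyperplanes, and the
Jacobians are tested against a cutoff `planeCutoff` that vanishes near all of them. As `ω` is only
`C¹`, the symmetry of second derivatives is used in the weak form `integral_fderiv_mul_fderiv_comm`.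
What remains is, for each hyperplane with unit normal `a`, the integral of `flux a ω Dω` against a
kernel concentrating on that hyperplane (`setIntegral_planeCutoff_gaffneyDefect`).

The kernel is odd across the hyperplane. Where both sides lie in `Ω`, or both outside, the two
contributions cancel in the limit; so hyperplanes that cut through the interior do no harm. Where
only one side lies in `Ω`, the hyperplane is a face, and there the flux itself is zero: the normal
is constant along the face, so the boundary condition may be differentiated tangentially
(`map_tangential_deriv_eq_zero`), and the condition together with its tangential derivatives
annihilates the flux (`flux_eq_zero_of_normal`, `flux_eq_zero_of_tangential`). Edges and vertices
project to a null set and are lost in the dominated convergence of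
`tendsto_setIntegral_planeCutoffCoeff_mul`. -/

noncomputable section

open Filter Topology

/-! ### Exterior algebra: inner product, wedge and contraction -/

namespace KForm

variable {n k : ℕ}

/-- The sum over increasing multi-indices of a function of multi-indices that is invariant under
permutations and vanishes on non-injective multi-indices, as an average over all multi-indices. -/
theorem sum_eq_factorial_mul_sum_orderEmbedding (F : (Fin k → Fin n) → ℝ)
    (hperm : ∀ I (σ : Equiv.Perm (Fin k)), F (I ∘ σ) = F I)
    (hinj : ∀ I, ¬ Function.Injective I → F I = 0) :
    ∑ I, F I = (k.factorial : ℝ) * ∑ I : Fin k ↪o Fin n, F I := by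
  classical
  have h1 : ∑ I, F I = ∑ I with Function.Injective I, F I := by
    rw [Finset.sum_filter]
    refine Finset.sum_congr rfl fun I _ => ?_
    split_ifs with h
    · rfl
    · exact hinj I h
  have h2 : ∑ p : (Fin k ↪o Fin n) × Equiv.Perm (Fin k), F p.1 =
      ∑ I with Function.Injective I, F I := by
    refine Finset.sum_bij (fun p _ => p.1 ∘ p.2) ?_ ?_ ?_ ?_
    · intro p _
      simpa using p.1.injective.comp p.2.injective
    · rintro ⟨I, σ⟩ _ ⟨J, τ⟩ _ h
      have h : I ∘ σ = J ∘ τ := h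
      have hr : Set.range I = Set.range J := by
        rw [← σ.surjective.range_comp I, h, τ.surjective.range_comp]
      obtain rfl : I = J := by
        apply OrderEmbedding.range_inj.1 hr
      have : σ = τ := by
        ext x
        have := congrFun h x
        exact congrArg _ (I.injective this)
      rw [this]
    · intro I hI
      have hI : Function.Injective I := by simpa using hI
      have hmono : StrictMono (I ∘ Tuple.sort I) :=
        (Tuple.monotone_sort I).strictMono_of_injective (hI.comp (Tuple.sort I).injective)
      refine ⟨(OrderEmbedding.ofStrictMono _ hmono, (Tuple.sort I)⁻¹), Finset.mem_univ _, ?_⟩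
      ext x
      simp
    · intro p _
      exact (hperm _ _).symm
  rw [h1, ← h2, Fintype.sum_prod_type]
  simp [Fintype.card_perm, Finset.mul_sum]

theorem component_comp_perm (ω : KForm n k) (I : Fin k → Fin n) (σ : Equiv.Perm (Fin k)) :
    ω.component (I ∘ σ) = (Equiv.Perm.sign σ : ℤ) * ω.component I := by
  have := ω.toAlternatingMap.map_perm (fun a => basisVec (I a)) σ
  simp only [ContinuousAlternatingMap.coe_toAlternatingMap] at this
  rw [component, component]
  rw [show (fun a => basisVec ((I ∘ σ) a)) = (fun a => basisVec (I a)) ∘ σ from rfl, this]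
  simp [Units.smul_def]

theorem component_eq_zero (ω : KForm n k) {I : Fin k → Fin n} (hI : ¬ Function.Injective I) :
    ω.component I = 0 := by
  simp only [Function.Injective, not_forall] at hI
  obtain ⟨a, b, hab, hne⟩ := hI
  exact ω.map_eq_zero_of_eq _ (by simp [hab]) hne

/-- The inner product of `k`-forms for which the forms `dx^{i₁} ∧ ⋯ ∧ dx^{iₖ}` are orthonormal. -/
def ip : KForm n k →ₗ[ℝ] KForm n k →ₗ[ℝ] ℝ :=
  LinearMap.mk₂ ℝ (fun α β => (k.factorial : ℝ)⁻¹ * ∑ I, α.component I * β.component I)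
    (fun α β γ => by simp [component, add_mul, Finset.sum_add_distrib, mul_add])
    (fun c α β => by simp [component, Finset.mul_sum, mul_left_comm, mul_assoc])
    (fun α β γ => by simp [component, Finset.sum_add_distrib, mul_add])
    (fun c α β => by simp [component, Finset.mul_sum, mul_left_comm])

theorem ip_apply (α β : KForm n k) :
    ip α β = (k.factorial : ℝ)⁻¹ * ∑ I, α.component I * β.component I := rfl

theorem ip_comm (α β : KForm n k) : ip α β = ip β α := by
  simp only [ip_apply, mul_comm]

/-- Each increasing multi-index has `k!` rearrangements, which differ in sign only; the factor
`(k!)⁻¹` in `ip` compensates for this. -/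
theorem normSq_eq_ip (α : KForm n k) : α.normSq = ip α α := by
  rw [ip_apply, sum_eq_factorial_mul_sum_orderEmbedding, ← mul_assoc, inv_mul_cancel₀, one_mul]
  · simp [normSq, sq]
  · exact_mod_cast k.factorial_ne_zero
  · intro I σ
    rw [component_comp_perm]
    rcases Int.units_eq_one_or (Equiv.Perm.sign σ) with h | h <;> simp [h]
  · intro I hI
    simp [component_eq_zero α hI]

theorem wedge_apply (ν : EuclideanSpace ℝ (Fin n)) (ω : KForm n k)
    (v : Fin (k + 1) → EuclideanSpace ℝ (Fin n)) :
    wedge ν ω v = ∑ i : Fin (k + 1), (-1) ^ (i : ℕ) * (inner ℝ ν (v i) * ω (i.removeNth v)) := by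
  simp [wedge, ContinuousAlternatingMap.alternatizeUncurryFin_apply]

theorem inner_basisVec (v : EuclideanSpace ℝ (Fin n)) (j : Fin n) :
    inner ℝ v (basisVec j) = v j := by
  simp [basisVec, EuclideanSpace.inner_single_right]

theorem sum_smul_basisVec (v : EuclideanSpace ℝ (Fin n)) : ∑ j, v j • basisVec j = v := by
  ext i
  simp [basisVec, Pi.single_apply]

theorem component_curryLeft (γ : KForm n (k + 1)) (j : Fin n) (I : Fin k → Fin n) :
    component (γ.curryLeft (basisVec j)) I = γ.component (Fin.cons j I) := by
  rw [component, component, ContinuousAlternatingMap.curryLeft_apply_apply]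
  congr 1
  ext a : 1
  refine Fin.cases ?_ (fun a => ?_) a <;> simp [Matrix.vecCons]

theorem component_insertNth (γ : KForm n (k + 1)) (p : Fin (k + 1)) (j : Fin n)
    (I : Fin k → Fin n) :
    γ.component (p.insertNth j I) = (-1) ^ (p : ℕ) * γ.component (Fin.cons j I) := by
  have := γ.toAlternatingMap.map_insertNth p (basisVec j) (fun a => basisVec (I a))
  simp only [ContinuousAlternatingMap.coe_toAlternatingMap] at this
  rw [component, component]
  convert this using 2
  · ext a : 1
    refine Fin.succAboveCases p ?_ (fun a => ?_) a <;> simp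
  · simp only [Int.reduceNeg, zsmul_eq_mul, Int.cast_pow, Int.cast_neg, Int.cast_one]
    congr 2
    ext a : 1
    refine Fin.cases ?_ (fun a => ?_) a <;> simp

/-- The exterior product with a covector is adjoint to the interior product. -/
theorem ip_wedge_left (v : EuclideanSpace ℝ (Fin n)) (β : KForm n k) (γ : KForm n (k + 1)) :
    ip (wedge v β) γ = ip β (γ.curryLeft v) := by
  -- Every slot `p` contributes the same amount: moving its index to the front costs a second
  -- `(-1)^p`. The `k + 1` equal terms turn `1/(k+1)!` into `1/k!`.
  have key : ∀ p : Fin (k + 1), ∑ J : Fin (k + 1) → Fin n,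
      (-1) ^ (p : ℕ) * (v (J p) * β.component (p.removeNth J)) * γ.component J =
      ∑ I : Fin k → Fin n, β.component I * component (γ.curryLeft v) I := by
    intro p
    rw [← (Fin.insertNthEquiv (fun _ => Fin n) p).sum_comp, Fintype.sum_prod_type,
      Finset.sum_comm]
    refine Finset.sum_congr rfl fun I _ => ?_
    have : component (γ.curryLeft v) I = ∑ j, v j * γ.component (Fin.cons j I) := by
      conv_lhs => rw [← sum_smul_basisVec v]
      simp only [map_sum, map_smul, ← component_curryLeft]
      simp [component]
    rw [this, Finset.mul_sum]
    refine Finset.sum_congr rfl fun j _ => ?_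
    rw [show Fin.insertNthEquiv (fun _ => Fin n) p (j, I) = p.insertNth j I from rfl,
      component_insertNth, Fin.insertNth_apply_same, Fin.removeNth_insertNth]
    have h1 : ((-1 : ℝ) ^ (p : ℕ)) * (-1) ^ (p : ℕ) = 1 := by
      rw [← mul_pow]; simp
    linear_combination (v j * β.component I * γ.component (Fin.cons j I)) * h1
  rw [ip_apply, ip_apply]
  have h2 : ∀ J : Fin (k + 1) → Fin n, (wedge v β).component J =
      ∑ p : Fin (k + 1), (-1) ^ (p : ℕ) * (v (J p) * β.component (p.removeNth J)) := by
    intro J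
    rw [component, wedge_apply]
    refine Finset.sum_congr rfl fun p _ => ?_
    rw [inner_basisVec]
    rfl
  simp only [h2, Finset.sum_mul]
  rw [Finset.sum_comm]
  simp only [key]
  rw [Finset.sum_const, Finset.card_univ, Fintype.card_fin, nsmul_eq_mul, Nat.factorial_succ]
  have : (k.factorial : ℝ) ≠ 0 := by exact_mod_cast k.factorial_ne_zero
  push_cast
  field_simp

/-- Contraction is an antiderivation: inserting `v` in the first slot isolates the term in which `w`
meets `v`, and every other slot is shifted by one, whence the minus sign. -/
theorem curryLeft_wedge (v w : EuclideanSpace ℝ (Fin n)) (α : KForm n (k + 1)) :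
    (wedge w α).curryLeft v = inner ℝ w v • α - wedge w (α.curryLeft v) := by
  ext u
  rw [ContinuousAlternatingMap.curryLeft_apply_apply, wedge_apply, Fin.sum_univ_succ]
  simp only [ContinuousAlternatingMap.sub_apply, ContinuousAlternatingMap.smul_apply, wedge_apply]
  simp only [Fin.val_zero, pow_zero, one_mul, Matrix.cons_val_zero, Matrix.cons_val_succ,
    smul_eq_mul, sub_eq_add_neg, ← Finset.sum_neg_distrib]
  congr 1
  refine Finset.sum_congr rfl fun i _ => ?_
  rw [ContinuousAlternatingMap.curryLeft_apply_apply]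
  have : i.succ.removeNth (Matrix.vecCons v u) = Matrix.vecCons v (i.removeNth u) := by
    ext a : 1
    refine Fin.cases ?_ (fun a => ?_) a
    · simp [Fin.removeNth]
    · simp [Fin.removeNth]
  rw [this, Fin.val_succ, pow_succ]
  ring

theorem curryLeft_wedge_zero (v w : EuclideanSpace ℝ (Fin n)) (α : KForm n 0) :
    (wedge w α).curryLeft v = inner ℝ w v • α := by
  ext u
  rw [ContinuousAlternatingMap.curryLeft_apply_apply, wedge_apply]
  simp

end KForm

/-! ### The pointwise identity and the boundary flux -/

namespace KForm

variable {n k : ℕ}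

/-- The interior product with a fixed vector as a continuous linear map. -/
def contractL (v : EuclideanSpace ℝ (Fin n)) : KForm n (k + 1) →L[ℝ] KForm n k :=
  (ContinuousLinearMap.apply ℝ (KForm n k) v).comp
    (ContinuousAlternatingMap.curryLeftLI (𝕜 := ℝ) (E := EuclideanSpace ℝ (Fin n)) (F := ℝ)
      (n := k)).toContinuousLinearMap

@[simp]
theorem contractL_apply (v : EuclideanSpace ℝ (Fin n)) (γ : KForm n (k + 1)) :
    contractL v γ = γ.curryLeft v := rfl

/-- The exterior product with a fixed covector as a continuous linear map. -/
def wedgeL (v : EuclideanSpace ℝ (Fin n)) : KForm n k →L[ℝ] KForm n (k + 1) :=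
  (ContinuousAlternatingMap.alternatizeUncurryFinCLM ℝ (EuclideanSpace ℝ (Fin n)) ℝ).comp
    (ContinuousLinearMap.smulRightL ℝ (EuclideanSpace ℝ (Fin n)) (KForm n k) (innerSL ℝ v))

/-- The component `γ^{i₁ ⋯ iₖ}` as a continuous linear functional. -/
def componentL (I : Fin k → Fin n) : KForm n k →L[ℝ] ℝ :=
  ContinuousAlternatingMap.apply ℝ (EuclideanSpace ℝ (Fin n)) ℝ (fun a => basisVec (I a))

theorem wedge_neg (v : EuclideanSpace ℝ (Fin n)) (β : KForm n k) :
    wedge (-v) β = -wedge v β := by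
  ext u
  simp [wedge_apply, Finset.sum_neg_distrib]

theorem alternatizeUncurryFin_eq_sum_wedge (L : EuclideanSpace ℝ (Fin n) →L[ℝ] KForm n k) :
    ContinuousAlternatingMap.alternatizeUncurryFin L =
      ∑ j, wedge (basisVec j) (L (basisVec j)) := by
  have : L = ∑ j, (innerSL ℝ (basisVec j)).smulRight (L (basisVec j)) := by
    ext1 v
    conv_lhs => rw [← sum_smul_basisVec v]
    simp only [map_sum, map_smul, sum_apply,
      ContinuousLinearMap.smulRight_apply, innerSL_apply_apply]
    refine Finset.sum_congr rfl fun j _ => ?_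
    rw [real_inner_comm, inner_basisVec]
  conv_lhs => rw [this, ← ContinuousAlternatingMap.alternatizeUncurryFinCLM_apply, map_sum]
  rfl

theorem normSq_alternatizeUncurryFin_zero (L : EuclideanSpace ℝ (Fin n) →L[ℝ] KForm n 0) :
    normSq (ContinuousAlternatingMap.alternatizeUncurryFin L) =
      ∑ j, (L (basisVec j)).normSq := by
  simp only [normSq_eq_ip]
  conv_lhs => arg 1; rw [alternatizeUncurryFin_eq_sum_wedge]
  rw [map_sum, LinearMap.sum_apply]
  refine Finset.sum_congr rfl fun i _ => ?_
  rw [ip_wedge_left, alternatizeUncurryFin_eq_sum_wedge, ← contractL_apply, map_sum]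
  simp only [contractL_apply, curryLeft_wedge_zero, inner_basisVec, map_sum]
  rw [Finset.sum_eq_single i]
  · simp [basisVec]
  · intro j _ hj
    simp [basisVec, hj.symm]
  · simp

/-- The difference `|dω|² + |δω|² - |∇ω|²` as a sum of Jacobian-type terms; here `L` is the
derivative of `ω`. -/
theorem normSq_alternatizeUncurryFin_add (L : EuclideanSpace ℝ (Fin n) →L[ℝ] KForm n (k + 1)) :
    normSq (ContinuousAlternatingMap.alternatizeUncurryFin L) +
      normSq (∑ j, (L (basisVec j)).curryLeft (basisVec j)) =
      ∑ j, (L (basisVec j)).normSq +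
      ∑ i, ∑ j, (ip ((L (basisVec i)).curryLeft (basisVec i))
          ((L (basisVec j)).curryLeft (basisVec j)) -
        ip ((L (basisVec i)).curryLeft (basisVec j))
          ((L (basisVec j)).curryLeft (basisVec i))) := by
  simp only [normSq_eq_ip, Finset.sum_sub_distrib]
  have h2 : ip (∑ j, (L (basisVec j)).curryLeft (basisVec j))
      (∑ j, (L (basisVec j)).curryLeft (basisVec j)) =
      ∑ i, ∑ j, ip ((L (basisVec i)).curryLeft (basisVec i))
          ((L (basisVec j)).curryLeft (basisVec j)) := by
    simp only [map_sum, LinearMap.sum_apply]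
    exact Finset.sum_comm
  have h1 : ip (ContinuousAlternatingMap.alternatizeUncurryFin L)
      (ContinuousAlternatingMap.alternatizeUncurryFin L) =
      ∑ j, ip (L (basisVec j)) (L (basisVec j)) - ∑ i, ∑ j,
        ip ((L (basisVec i)).curryLeft (basisVec j))
          ((L (basisVec j)).curryLeft (basisVec i)) := by
    conv_lhs => arg 1; rw [alternatizeUncurryFin_eq_sum_wedge]
    rw [map_sum, LinearMap.sum_apply, ← Finset.sum_sub_distrib]
    refine Finset.sum_congr rfl fun i _ => ?_
    -- After adjointness, anticommutation splits the contraction of `e_j ∧ ∂_j ω` with `e_i`: the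
    -- Kronecker delta yields `|∇ω|²`, the rest the mixed terms.
    rw [ip_wedge_left, alternatizeUncurryFin_eq_sum_wedge, ← contractL_apply, map_sum]
    simp only [contractL_apply, curryLeft_wedge, inner_basisVec, map_sum, map_sub,
      Finset.sum_sub_distrib]
    congr 1
    · rw [Finset.sum_eq_single i]
      · simp [basisVec]
      · intro j _ hj
        simp [basisVec, hj.symm]
      · simp
    · refine Finset.sum_congr rfl fun j _ => ?_
      rw [ip_comm, ip_wedge_left, ip_comm]
  rw [h1, h2]
  ring

/-- The boundary flux in the integrated form of `normSq_alternatizeUncurryFin_add`: here `a` is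
the normal, `α` the value and `L` the derivative of the form. -/
def flux (a : EuclideanSpace ℝ (Fin n)) (α : KForm n (k + 1))
    (L : EuclideanSpace ℝ (Fin n) →L[ℝ] KForm n (k + 1)) : ℝ :=
  ∑ j, ip (α.curryLeft a) ((L (basisVec j)).curryLeft (basisVec j)) -
    ∑ i, ip (α.curryLeft (basisVec i)) ((L (basisVec i)).curryLeft a)

theorem sum_inner_smul_basisVec_sub (a : EuclideanSpace ℝ (Fin n)) (ha : ‖a‖ = 1) :
    ∑ j, a j • (basisVec j - a j • a) = 0 := by
  have h : ∑ j, a j * a j = 1 := by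
    have := EuclideanSpace.real_norm_sq_eq a
    rw [ha] at this
    simpa [sq] using this.symm
  simp only [smul_sub, Finset.sum_sub_distrib, sum_smul_basisVec, smul_smul, ← Finset.sum_smul, h,
    one_smul, sub_self]

theorem inner_basisVec_sub (a : EuclideanSpace ℝ (Fin n)) (ha : ‖a‖ = 1) (j : Fin n) :
    inner ℝ a (basisVec j - a j • a) = 0 := by
  rw [inner_sub_right, inner_basisVec, inner_smul_right, real_inner_self_eq_norm_sq, ha]
  ring

/-- Only the normal part of `e_i` survives in the contraction of `L e_i` with `a`, so the second sum
of the flux collapses to a pairing with the contraction of `α` with `a`, which is zero; the first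
sum contains that factor already. -/
theorem flux_eq_zero_of_normal {a : EuclideanSpace ℝ (Fin n)} (ha : ‖a‖ = 1)
    {α : KForm n (k + 1)} {L : EuclideanSpace ℝ (Fin n) →L[ℝ] KForm n (k + 1)}
    (h0 : α.curryLeft a = 0) (h1 : ∀ t, inner ℝ a t = 0 → (L t).curryLeft a = 0) :
    flux a α L = 0 := by
  have h2 : ∀ i, (L (basisVec i)).curryLeft a = a i • (L a).curryLeft a := by
    intro i
    have := h1 _ (inner_basisVec_sub a ha i)
    rw [map_sub, map_smul, ← contractL_apply, map_sub, map_smul, sub_eq_zero] at this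
    exact this
  have h3 : ∑ i, ip (α.curryLeft (basisVec i)) (a i • (L a).curryLeft a) =
      ip (α.curryLeft a) ((L a).curryLeft a) := by
    conv_rhs => rw [← sum_smul_basisVec a, map_sum, map_sum, LinearMap.sum_apply]
    simp [sum_smul_basisVec]
  rw [flux]
  simp only [h2, h3, h0]
  simp

/-- In `v ⌟ (a ∧ β) = ⟨a, v⟩ β - a ∧ (v ⌟ β)` the last term is orthogonal to `a ⌟ γ`, because
contracting twice with `a` gives zero. -/
theorem ip_curryLeft_wedge_curryLeft (a v : EuclideanSpace ℝ (Fin n)) (β : KForm n k)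
    (γ : KForm n (k + 1)) :
    ip ((wedge a β).curryLeft v) (γ.curryLeft a) = inner ℝ a v * ip β (γ.curryLeft a) := by
  cases k with
  | zero => rw [curryLeft_wedge_zero]; simp
  | succ k =>
    rw [curryLeft_wedge, map_sub, LinearMap.sub_apply, ip_wedge_left,
      ContinuousAlternatingMap.curryLeft_same]
    simp

/-- A form killed by `a ∧ ·` is `a ∧ β` with `β` its contraction with `a`; this applies to `α` and
to every tangential `L t`. Both sums of the flux then reduce to `⟨β, a ⌟ L a⟩`: in the first one,
`e_j` is split into its tangential part `t_j` and `a_j a`, and the tangential parts drop out since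
`∑ a_j t_j = 0`. -/
theorem flux_eq_zero_of_tangential {a : EuclideanSpace ℝ (Fin n)} (ha : ‖a‖ = 1)
    {α : KForm n (k + 1)} {L : EuclideanSpace ℝ (Fin n) →L[ℝ] KForm n (k + 1)}
    (h0 : wedge a α = 0) (h1 : ∀ t, inner ℝ a t = 0 → wedge a (L t) = 0) :
    flux a α L = 0 := by
  have eqw : ∀ γ : KForm n (k + 1), wedge a γ = 0 → γ = wedge a (γ.curryLeft a) := by
    intro γ h
    have := curryLeft_wedge a a γ
    rw [h, real_inner_self_eq_norm_sq, ha] at this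
    simp only [ContinuousAlternatingMap.curryLeft_zero, zero_apply] at this
    rw [one_pow, one_smul] at this
    exact sub_eq_zero.1 this.symm
  set β : KForm n k := α.curryLeft a with hβ
  have hα : α = wedge a β := eqw α h0
  have h2 : ∑ i, ip (α.curryLeft (basisVec i)) ((L (basisVec i)).curryLeft a) =
      ip β ((L a).curryLeft a) := by
    conv_lhs => rw [hα]
    simp only [ip_curryLeft_wedge_curryLeft, inner_basisVec]
    have : ip β (contractL a (L (∑ j, a j • basisVec j))) = ip β ((L a).curryLeft a) := by
      rw [sum_smul_basisVec, contractL_apply]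
    simpa only [map_sum, map_smul, smul_eq_mul, contractL_apply] using this
  have h3 : ∀ j, ip β ((L (basisVec j)).curryLeft (basisVec j)) =
      a j * ip β ((L (basisVec j - a j • a)).curryLeft a) +
      a j * ip β ((L a).curryLeft (basisVec j)) := by
    intro j
    set t := basisVec j - a j • a with ht
    have e1 : L (basisVec j) = L t + a j • L a := by rw [ht, map_sub, map_smul]; abel
    have e2 := eqw (L t) (h1 t (inner_basisVec_sub a ha j))
    have e3 : ip β ((L t).curryLeft (basisVec j)) = a j * ip β ((L t).curryLeft a) := by
      rw [ip_comm]
      conv_lhs => rw [e2]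
      rw [hβ, ip_curryLeft_wedge_curryLeft, inner_basisVec, ip_comm]
    rw [e1, ← contractL_apply, map_add, map_add, contractL_apply, e3]
    simp
  have h4 : ∑ j, a j * ip β ((L (basisVec j - a j • a)).curryLeft a) = 0 := by
    have : ip β (contractL a (L (∑ j, a j • (basisVec j - a j • a)))) = 0 := by
      rw [sum_inner_smul_basisVec_sub a ha]; simp
    simpa only [map_sum, map_smul, smul_eq_mul, contractL_apply] using this
  have h5 : ∑ j, a j * ip β ((L a).curryLeft (basisVec j)) = ip β ((L a).curryLeft a) := by
    have : ip β ((L a).curryLeft (∑ j, a j • basisVec j)) = ip β ((L a).curryLeft a) := by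
      rw [sum_smul_basisVec]
    simpa only [map_sum, map_smul, smul_eq_mul] using this
  rw [flux, h2]
  simp only [← hβ, h3, Finset.sum_add_distrib, h4, h5]
  simp

end KForm

/-! ### Weak symmetry of second derivatives -/

section IntegrationByParts

variable {E : Type*} [NormedAddCommGroup E] [NormedSpace ℝ E] [MeasurableSpace E] [BorelSpace E]
  [FiniteDimensional ℝ E] {μ : Measure E} [μ.IsAddHaarMeasure]

theorem LipschitzWith.integrable_lineDeriv_of_hasCompactSupport {C : NNReal} {f : E → ℝ}
    (hf : LipschitzWith C f) (h'f : HasCompactSupport f) (v : E) :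
    Integrable (fun x => lineDeriv ℝ f x v) μ := by
  rw [← integrableOn_iff_integrable_of_support_subset (s := tsupport f)]
  · exact (hf.locallyIntegrable_lineDeriv v).integrableOn_isCompact h'f
  · intro x hx
    by_contra hxs
    apply hx
    have h0 : f =ᶠ[𝓝 x] fun _ => (0 : ℝ) := notMem_tsupport_iff_eventuallyEq.1 hxs
    change lineDeriv ℝ f x v = 0
    rw [h0.lineDeriv_eq]
    simp [lineDeriv]

/-- Symmetry of the second derivatives in weak form. -/
theorem integral_fderiv_mul_fderiv_comm {C D : NNReal} {f g : E → ℝ} {f' g' : E → E →L[ℝ] ℝ}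
    (hf : LipschitzWith C f) (h'f : HasCompactSupport f) (hf' : ∀ x, HasFDerivAt f (f' x) x)
    (hg : LipschitzWith D g) (h'g : HasCompactSupport g) (hg' : ∀ x, HasFDerivAt g (g' x) x)
    (a b : E) :
    ∫ x, f' x a * g' x b ∂μ = ∫ x, f' x b * g' x a ∂μ := by
  have lf : ∀ x v, lineDeriv ℝ f x v = f' x v := fun x v => ((hf' x).hasLineDerivAt v).lineDeriv
  have lg : ∀ x v, lineDeriv ℝ g x v = g' x v := fun x v => ((hg' x).hasLineDerivAt v).lineDeriv
  have If : Integrable (fun x => f' x a) μ := by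
    simpa only [lf] using hf.integrable_lineDeriv_of_hasCompactSupport h'f a
  have Ig : Integrable (fun x => g' x a) μ := by
    simpa only [lg] using hg.integrable_lineDeriv_of_hasCompactSupport h'g a
  -- The derivative in direction `b` is replaced by a difference quotient. Before the limit,
  -- integrating by parts in direction `a` and translating moves the difference from `g` to `f`,
  -- with step `-b`; no second derivative ever appears.
  have T1 := hg.integral_inv_smul_sub_mul_tendsto_integral_lineDeriv_mul If b
  have T2 := (hf.integral_inv_smul_sub_mul_tendsto_integral_lineDeriv_mul Ig (-b)).neg
  have key : ∀ t : ℝ, ∫ x, (t⁻¹ • (g (x + t • b) - g x)) * f' x a ∂μ =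
      -∫ x, (t⁻¹ • (f (x + t • -b) - f x)) * g' x a ∂μ := by
    intro t
    have hgt : LipschitzWith D (fun x => g (x + t • b)) := by
      simpa [Function.comp_def] using hg.comp (isometry_add_right (t • b)).lipschitz
    have hgt' : HasCompactSupport (fun x => g (x + t • b)) :=
      h'g.comp_homeomorph (Homeomorph.addRight (t • b))
    have lgt : ∀ x v, lineDeriv ℝ (fun x => g (x + t • b)) x v = g' (x + t • b) v := fun x v =>
      (((hasFDerivAt_comp_add_right (t • b)).2 (hg' (x + t • b))).hasLineDerivAt v).lineDeriv
    have e1 : ∫ x, f' x a * g (x + t • b) ∂μ = -∫ x, g' x a * f (x + t • -b) ∂μ := by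
      have := hf.integral_lineDeriv_mul_eq (μ := μ) hgt hgt' a
      simp only [lf, lgt] at this
      rw [this, ← integral_add_right_eq_self _ (t • -b)]
      simp [integral_neg]
    have e2 : ∫ x, f' x a * g x ∂μ = -∫ x, g' x a * f x ∂μ := by
      have := hf.integral_lineDeriv_mul_eq (μ := μ) hg h'g a
      simp only [lf, lg] at this
      rw [this]
      simp [integral_neg]
    have bdd : ∀ {F : E → ℝ}, Continuous F → HasCompactSupport F → ∃ c, ∀ x, ‖F x‖ ≤ c :=
      fun hF h'F => hF.bounded_above_of_compact_support h'F |>.imp fun _ h => h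
    have int : ∀ {F φ : E → ℝ}, Continuous F → HasCompactSupport F → Integrable φ μ →
        Integrable (fun x => φ x * F x) μ := by
      intro F φ hF h'F hφ
      obtain ⟨c, hc⟩ := bdd hF h'F
      exact hφ.mul_bdd hF.aestronglyMeasurable (Eventually.of_forall hc)
    have hft : Continuous (fun x => f (x + t • -b)) := hf.continuous.comp (by fun_prop)
    have hft' : HasCompactSupport (fun x => f (x + t • -b)) :=
      h'f.comp_homeomorph (Homeomorph.addRight (t • -b))
    have s1 : ∀ x, (t⁻¹ • (g (x + t • b) - g x)) * f' x a =
        t⁻¹ * (f' x a * g (x + t • b) - f' x a * g x) := fun x => by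
      rw [smul_eq_mul]; ring
    have s2 : ∀ x, (t⁻¹ • (f (x + t • -b) - f x)) * g' x a =
        t⁻¹ * (g' x a * f (x + t • -b) - g' x a * f x) := fun x => by
      rw [smul_eq_mul]; ring
    simp only [s1, s2, integral_const_mul]
    rw [integral_sub (int hgt.continuous hgt' If) (int hg.continuous h'g If),
      integral_sub (int hft hft' Ig) (int hf.continuous h'f Ig), e1, e2]
    ring
  have := tendsto_nhds_unique T1 (T2.congr fun t => (key t).symm)
  simp only [lf, lg, map_neg, neg_mul, integral_neg, neg_neg] at this
  rw [← this]
  simp only [mul_comm]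

end IntegrationByParts

/-! ### Hyperplanes and dilations normal to them -/

section HyperplaneScaling

variable {E : Type*} [NormedAddCommGroup E] [InnerProductSpace ℝ E]

/-- The signed distance to the hyperplane `⟨h.1, x⟩ = h.2`, if `h.1` is a unit vector. -/
def planeDist (h : E × ℝ) (x : E) : ℝ := inner ℝ h.1 x - h.2

/-- The dilation by the factor `c` in the direction normal to a hyperplane. -/
def planeDilation (h : E × ℝ) (c : ℝ) (x : E) : E := x + ((c - 1) * planeDist h x) • h.1

theorem continuous_planeDist (h : E × ℝ) : Continuous (planeDist h) := by
  unfold planeDist; fun_prop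

theorem planeDist_add (h : E × ℝ) (x v : E) :
    planeDist h (x + v) = planeDist h x + inner ℝ h.1 v := by
  simp only [planeDist, inner_add_right]; ring

theorem hasFDerivAt_planeDist (h : E × ℝ) (x : E) :
    HasFDerivAt (planeDist h) (innerSL ℝ h.1) x :=
  (innerSL ℝ h.1).hasFDerivAt.sub_const h.2

theorem planeDist_planeDilation {h : E × ℝ} (hh : ‖h.1‖ = 1) (c : ℝ) (x : E) :
    planeDist h (planeDilation h c x) = c * planeDist h x := by
  rw [planeDilation, planeDist_add, inner_smul_right, real_inner_self_eq_norm_sq, hh]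
  ring

theorem planeDilation_eq (h : E × ℝ) (c : ℝ) (x : E) :
    planeDilation h c x = planeDilation h 0 x + (c * planeDist h x) • h.1 := by
  simp only [planeDilation, add_assoc, ← add_smul]
  ring_nf

theorem continuous_planeDilation (h : E × ℝ) (c : ℝ) : Continuous (planeDilation h c) := by
  have := continuous_planeDist h
  unfold planeDilation
  fun_prop

variable [MeasurableSpace E] [BorelSpace E] [FiniteDimensional ℝ E]

/-- Up to a translation the dilation is a transvection along the unit normal, with determinant `1 +
(c - 1) = c`. -/
theorem integral_comp_planeDilation {h : E × ℝ} (hh : ‖h.1‖ = 1) {c : ℝ} (hc : c ≠ 0)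
    (F : E → ℝ) :
    ∫ x, F (planeDilation h c x) = |c|⁻¹ * ∫ x, F x := by
  let T : E →ₗ[ℝ] E := LinearMap.transvection (innerSL ℝ h.1 : E →L[ℝ] ℝ).toLinearMap
    ((c - 1) • h.1)
  have hT : LinearMap.det T = c := by
    rw [LinearMap.transvection.det]
    simp [hh]
  have hT0 : LinearMap.det T ≠ 0 := by rwa [hT]
  have e : ∀ x, planeDilation h c x = T x + -((c - 1) * h.2) • h.1 := by
    intro x
    simp only [planeDilation, planeDist, T, LinearMap.transvection.apply,
      ContinuousLinearMap.coe_coe, innerSL_apply_apply, smul_smul, add_assoc, ← add_smul]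
    congr 2
    ring
  have hemb : MeasurableEmbedding T :=
    (LinearMap.equivOfDetNeZero T hT0).toContinuousLinearEquiv.toHomeomorph.measurableEmbedding
  simp only [e]
  rw [← hemb.integral_map (μ := volume) (fun x => F (x + -((c - 1) * h.2) • h.1)),
    Measure.map_linearMap_addHaar_eq_smul_addHaar _ hT0, integral_smul_measure, hT,
    integral_add_right_eq_self, abs_inv]
  simp

theorem ae_inner_ne {w : E} {β : ℝ} (hw : ∃ x, inner ℝ w x ≠ β) :
    ∀ᵐ x : E, inner ℝ w x ≠ β := by
  let S : AffineSubspace ℝ E :=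
    { carrier := {x | inner ℝ w x = β}
      smul_vsub_vadd_mem' := by
        intro c x y z hx hy hz
        simp only [Set.mem_ofPred_eq, vsub_eq_sub, vadd_eq_add, inner_add_right, inner_smul_right,
          inner_sub_right] at *
        rw [hx, hy, hz]; ring }
  have hS : S ≠ ⊤ := by
    obtain ⟨x, hx⟩ := hw
    intro h
    apply hx
    have : x ∈ S := h ▸ AffineSubspace.mem_top ℝ E x
    exact this
  have := Measure.addHaar_affineSubspace volume S hS
  rw [ae_iff]
  convert this using 2
  ext x
  simp only [not_not]
  rfl

end HyperplaneScaling

/-! ### Sets covered by finitely many hyperplanes -/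

section Planes

variable {E : Type*} [NormedAddCommGroup E] [InnerProductSpace ℝ E]

/-- `X` lies in a finite union of hyperplanes. -/
def CoveredByPlanes (X : Set E) : Prop :=
  ∃ s : Finset (E × ℝ), (∀ h ∈ s, ‖h.1‖ = 1) ∧ ∀ x ∈ X, ∃ h ∈ s, planeDist h x = 0

theorem CoveredByPlanes.mono {X Y : Set E} (hY : CoveredByPlanes Y) (h : X ⊆ Y) :
    CoveredByPlanes X := by
  obtain ⟨s, hs, hc⟩ := hY
  exact ⟨s, hs, fun x hx => hc x (h hx)⟩

theorem CoveredByPlanes.empty : CoveredByPlanes (∅ : Set E) := ⟨∅, by simp, by simp⟩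

theorem CoveredByPlanes.union {X Y : Set E} (hX : CoveredByPlanes X) (hY : CoveredByPlanes Y) :
    CoveredByPlanes (X ∪ Y) := by
  classical
  obtain ⟨s, hs, hc⟩ := hX
  obtain ⟨t, ht, hd⟩ := hY
  refine ⟨s ∪ t, ?_, ?_⟩
  · intro h hh
    rcases Finset.mem_union.1 hh with hh | hh
    · exact hs h hh
    · exact ht h hh
  · rintro x (hx | hx)
    · obtain ⟨h, hh, hx⟩ := hc x hx
      exact ⟨h, Finset.mem_union_left _ hh, hx⟩
    · obtain ⟨h, hh, hx⟩ := hd x hx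
      exact ⟨h, Finset.mem_union_right _ hh, hx⟩

theorem CoveredByPlanes.frontier_sUnion {S : Set (Set E)} (hS : S.Finite)
    (h : ∀ P ∈ S, CoveredByPlanes (frontier P)) : CoveredByPlanes (frontier (⋃₀ S)) := by
  induction S, hS using Set.Finite.induction_on with
  | empty => simpa using CoveredByPlanes.empty
  | insert _ _ ih =>
    rw [Set.sUnion_insert]
    refine ((h _ (Set.mem_insert _ _)).union
      (ih fun P hP => h P (Set.mem_insert_of_mem _ hP))).mono ?_
    exact (frontier_union_subset _ _).trans
      (Set.union_subset_union Set.inter_subset_left Set.inter_subset_right)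

/-- The second normal is orthogonal to all directions of the first plane, hence a multiple of its
normal, by a factor of modulus one; the foot point `h.2 • h.1` then fixes the offset. -/
theorem eq_or_eq_neg_of_planes_subset {h h' : E × ℝ} (hh : ‖h.1‖ = 1) (hh' : ‖h'.1‖ = 1)
    (hsub : ∀ y, planeDist h y = 0 → planeDist h' y = 0) : h' = h ∨ h' = -h := by
  have h0 : planeDist h (h.2 • h.1) = 0 := by
    simp [planeDist, inner_smul_right, hh]
  have h0' := hsub _ h0
  have ht : ∀ t, inner ℝ h.1 t = 0 → inner ℝ h'.1 t = 0 := by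
    intro t ht
    have := hsub (h.2 • h.1 + t) (by rw [planeDist_add, h0, ht, add_zero])
    rwa [planeDist_add, h0', zero_add] at this
  set c : ℝ := inner ℝ h.1 h'.1 with hc
  have hperp : inner ℝ h.1 (h'.1 - c • h.1) = 0 := by
    rw [inner_sub_right, inner_smul_right, real_inner_self_eq_norm_sq, hh, hc]; ring
  have h1 : h'.1 = c • h.1 := by
    rw [← sub_eq_zero, ← inner_self_eq_zero (𝕜 := ℝ)]
    conv_lhs => rw [inner_sub_left, inner_smul_left, ht _ hperp, hperp]
    simp
  have hc1 : |c| = 1 := by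
    have := congrArg norm h1
    rw [norm_smul, hh, hh', mul_one] at this
    exact this.symm
  have h2 : h'.2 = c * h.2 := by
    rw [planeDist, inner_smul_right, real_inner_comm, ← hc] at h0'
    linarith
  rcases (abs_eq zero_le_one).1 hc1 with hc1 | hc1
  · left; ext1
    · rw [h1, hc1, one_smul]
    · rw [h2, hc1, one_mul]
  · right; ext1
    · rw [h1, hc1, neg_one_smul]; rfl
    · rw [h2, hc1, neg_one_mul]; rfl

/-- The hyperplanes of a covering may be chosen pairwise different. -/
theorem CoveredByPlanes.exists_distinct {X : Set E} (hX : CoveredByPlanes X) :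
    ∃ s : Finset (E × ℝ), (∀ h ∈ s, ‖h.1‖ = 1) ∧
      (∀ h ∈ s, ∀ h' ∈ s, h' ≠ h → ∃ y, planeDist h y = 0 ∧ planeDist h' y ≠ 0) ∧
      ∀ x ∈ X, ∃ h ∈ s, planeDist h x = 0 := by
  classical
  obtain ⟨s, hs, hc⟩ := hX
  -- One representative per zero set: a plane occurring as both `h` and `-h` would otherwise be
  -- counted twice.
  obtain ⟨t, hts, ht⟩ := (s : Set (E × ℝ)).exists_subset_bijOn (fun h => {x | planeDist h x = 0})
  have htf : t.Finite := s.finite_toSet.subset hts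
  refine ⟨htf.toFinset, fun h hh => hs h (hts (by simpa using hh)), ?_, ?_⟩
  · intro h hh h' hh' hne
    rw [Set.Finite.mem_toFinset] at hh hh'
    by_contra! hcon
    apply hne
    rcases eq_or_eq_neg_of_planes_subset (hs h (hts hh)) (hs h' (hts hh')) hcon with h1 | h1
    · exact h1
    · apply ht.injOn hh' hh
      ext x
      have : planeDist h' x = -planeDist h x := by
        rw [h1]; simp [planeDist]; ring
      simp [this]
  · intro x hx
    obtain ⟨h, hh, hx⟩ := hc x hx
    obtain ⟨h', hh', he⟩ := ht.surjOn (Set.mem_image_of_mem _ hh)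
    refine ⟨h', by simpa using hh', ?_⟩
    have : x ∈ {x | planeDist h' x = 0} := by
      have he : {x | planeDist h' x = 0} = {x | planeDist h x = 0} := he
      rw [he]; exact hx
    exact this

end Planes

/-! ### Boundaries of polytopes lie in finitely many hyperplanes -/

namespace Polytopes

variable {n : ℕ}

theorem IsConvexPolytope.coveredByPlanes_frontier {P : Set (EuclideanSpace ℝ (Fin n))}
    (hP : IsConvexPolytope P) : CoveredByPlanes (frontier P) := by
  classical
  obtain ⟨-, s, rfl⟩ := hP
  -- Constraints with zero normal do not depend on the point and define no hyperplane. If no other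
  -- constraint is active at a point of the polytope, all of them persist nearby and the point is
  -- interior.
  refine ⟨(s.filter fun h => h.1 ≠ 0).image fun h => (‖h.1‖⁻¹ • h.1, ‖h.1‖⁻¹ * h.2), ?_, ?_⟩
  · intro h hh
    obtain ⟨g, hg, rfl⟩ := Finset.mem_image.1 hh
    have : ‖g.1‖ ≠ 0 := norm_ne_zero_iff.2 (Finset.mem_filter.1 hg).2
    simp [norm_smul, this]
  · intro x hx
    have hcl : IsClosed {x : EuclideanSpace ℝ (Fin n) | ∀ h ∈ s, inner ℝ h.1 x ≤ h.2} := by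
      simp only [Set.ofPred_forall]
      exact isClosed_biInter fun h _ => isClosed_le (by fun_prop) continuous_const
    have hxP : ∀ h ∈ s, inner ℝ h.1 x ≤ h.2 := hcl.frontier_subset hx
    by_contra! hcon
    apply hx.2
    rw [mem_interior_iff_mem_nhds]
    change ∀ᶠ y in 𝓝 x, ∀ h ∈ s, inner ℝ h.1 y ≤ h.2
    rw [Filter.eventually_all_finset]
    intro h hh
    by_cases h0 : h.1 = 0
    · have := hxP h hh
      rw [h0] at this ⊢
      simpa using this
    · have hne : inner ℝ h.1 x ≠ h.2 := by
        intro he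
        apply hcon (‖h.1‖⁻¹ • h.1, ‖h.1‖⁻¹ * h.2)
          (Finset.mem_image_of_mem (fun h : EuclideanSpace ℝ (Fin n) × ℝ =>
            (‖h.1‖⁻¹ • h.1, ‖h.1‖⁻¹ * h.2)) (Finset.mem_filter.2 ⟨hh, h0⟩))
        simp [planeDist, inner_smul_left, he]
      have hlt : inner ℝ h.1 x < h.2 := lt_of_le_of_ne (hxP h hh) hne
      have hcont : ContinuousAt (fun y => inner ℝ h.1 y) x := by fun_prop
      exact (hcont.eventually_lt continuousAt_const hlt).mono fun _ h => h.le

theorem IsOpenPolytope.coveredByPlanes_frontier {U : Set (EuclideanSpace ℝ (Fin n))}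
    (hU : IsOpenPolytope U) : CoveredByPlanes (frontier U) := by
  obtain ⟨S, hS, hP, rfl⟩ := hU
  exact (CoveredByPlanes.frontier_sUnion hS fun P h => (hP P h).coveredByPlanes_frontier).mono
    frontier_interior_subset

theorem IsOpenPolytope.isBounded {U : Set (EuclideanSpace ℝ (Fin n))}
    (hU : IsOpenPolytope U) : Bornology.IsBounded U := by
  obtain ⟨S, hS, hP, rfl⟩ := hU
  exact ((Bornology.isBounded_sUnion hS).2 fun P h => (hP P h).1).subset interior_subset

theorem IsOpenPolytope.isOpen {U : Set (EuclideanSpace ℝ (Fin n))}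
    (hU : IsOpenPolytope U) : IsOpen U := by
  obtain ⟨S, hS, hP, rfl⟩ := hU
  exact isOpen_interior

theorem IsGeneralizedPolytope.isOpen {Ω : Set (EuclideanSpace ℝ (Fin n))}
    (hΩ : IsGeneralizedPolytope Ω) : IsOpen Ω := by
  obtain ⟨Ω₀, M, H, h0, -, -, -, rfl⟩ := hΩ
  exact h0.isOpen.sdiff (isClosed_iUnion_of_finite fun i => isClosed_closure)

theorem IsGeneralizedPolytope.isBounded {Ω : Set (EuclideanSpace ℝ (Fin n))}
    (hΩ : IsGeneralizedPolytope Ω) : Bornology.IsBounded Ω := by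
  obtain ⟨Ω₀, M, H, h0, -, -, -, rfl⟩ := hΩ
  exact h0.isBounded.subset Set.sdiff_subset

theorem IsGeneralizedPolytope.coveredByPlanes_frontier {Ω : Set (EuclideanSpace ℝ (Fin n))}
    (hΩ : IsGeneralizedPolytope Ω) : CoveredByPlanes (frontier Ω) := by
  obtain ⟨Ω₀, M, H, h0, hH, -, -, rfl⟩ := hΩ
  have h1 : CoveredByPlanes (frontier (⋃ i, closure (H i))) := by
    rw [← Set.sUnion_range]
    refine CoveredByPlanes.frontier_sUnion (Set.finite_range _) ?_
    rintro _ ⟨i, rfl⟩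
    exact (hH i).coveredByPlanes_frontier.mono frontier_closure_subset
  refine (h0.coveredByPlanes_frontier.union h1).mono ?_
  rw [Set.sdiff_eq]
  refine (frontier_inter_subset _ _).trans ?_
  rw [frontier_compl]
  exact Set.union_subset_union Set.inter_subset_left Set.inter_subset_right

end Polytopes

/-! ### The one-dimensional cutoff -/

/-- A smooth even function that vanishes on `[-1, 1]` and is `1` far away from `0`. -/
def evenCutoff (t : ℝ) : ℝ := Real.smoothTransition (t ^ 2 - 1)

namespace evenCutoff

theorem contDiff : ContDiff ℝ 1 evenCutoff := by
  have : ContDiff ℝ 1 Real.smoothTransition := Real.smoothTransition.contDiff (n := 1)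
  exact this.comp (by fun_prop)

theorem continuous : Continuous evenCutoff := contDiff.continuous

theorem continuous_deriv : Continuous (deriv evenCutoff) := contDiff.continuous_deriv le_rfl

theorem hasDerivAt (t : ℝ) : HasDerivAt evenCutoff (deriv evenCutoff t) t :=
  (contDiff.differentiable one_ne_zero t).hasDerivAt

theorem nonneg (t : ℝ) : 0 ≤ evenCutoff t := Real.smoothTransition.nonneg _

theorem le_one (t : ℝ) : evenCutoff t ≤ 1 := Real.smoothTransition.le_one _

theorem eq_zero {t : ℝ} (ht : t ^ 2 ≤ 1) : evenCutoff t = 0 :=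
  Real.smoothTransition.zero_of_nonpos (by linarith)

theorem eq_one {t : ℝ} (ht : 2 ≤ t ^ 2) : evenCutoff t = 1 :=
  Real.smoothTransition.one_of_one_le (by linarith)

theorem deriv_eq_zero_of_lt {t : ℝ} (ht : t ^ 2 < 1) : deriv evenCutoff t = 0 := by
  have : evenCutoff =ᶠ[𝓝 t] fun _ => 0 := by
    have hc : ContinuousAt (fun t : ℝ => t ^ 2) t := by fun_prop
    exact (hc.eventually_lt continuousAt_const ht).mono fun x hx => eq_zero (le_of_lt hx)
  rw [this.deriv_eq]
  simp

theorem deriv_eq_zero_of_gt {t : ℝ} (ht : 2 < t ^ 2) : deriv evenCutoff t = 0 := by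
  have : evenCutoff =ᶠ[𝓝 t] fun _ => 1 := by
    have hc : ContinuousAt (fun t : ℝ => t ^ 2) t := by fun_prop
    exact (continuousAt_const.eventually_lt hc ht).mono fun x hx => eq_one (le_of_lt hx)
  rw [this.deriv_eq]
  simp

/-- This oddness gives the two sides of a hyperplane opposite weights, which makes interior
hyperplanes cancel. -/
theorem deriv_neg (t : ℝ) : deriv evenCutoff (-t) = -deriv evenCutoff t := by
  have h : (fun s => evenCutoff (-s)) = evenCutoff := by
    ext s; simp [evenCutoff]
  have := deriv_comp_neg evenCutoff t
  rw [h] at this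
  rw [this, neg_neg]

theorem exists_abs_deriv_le : ∃ B, ∀ t, |deriv evenCutoff t| ≤ B := by
  obtain ⟨B, hB⟩ := (isCompact_Icc (a := (-2 : ℝ)) (b := 2)).exists_bound_of_continuousOn
    continuous_deriv.continuousOn
  refine ⟨max B 0, fun t => ?_⟩
  by_cases ht : t ∈ Set.Icc (-2 : ℝ) 2
  · exact (hB t ht).trans (le_max_left _ _)
  · rw [deriv_eq_zero_of_gt, abs_zero]
    · exact le_max_right _ _
    · rw [Set.mem_Icc, not_and_or, not_le, not_le] at ht
      rcases ht with ht | ht <;> nlinarith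

end evenCutoff

/-! ### Cutoffs near hyperplanes and integration of Jacobians -/

section PlaneCutoff

variable {E : Type*} [NormedAddCommGroup E] [InnerProductSpace ℝ E] {s : Finset (E × ℝ)}

/-- A cutoff function that vanishes in the `ε`-neighbourhood of finitely many hyperplanes. -/
def planeCutoff (s : Finset (E × ℝ)) (ε : ℝ) (x : E) : ℝ :=
  ∏ h ∈ s, evenCutoff (planeDist h x / ε)

open Classical in
/-- The derivative of `planeCutoff` is the linear combination of the normals with these
coefficients. -/
def planeCutoffCoeff (s : Finset (E × ℝ)) (ε : ℝ) (h : E × ℝ) (x : E) : ℝ :=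
  (∏ h' ∈ s.erase h, evenCutoff (planeDist h' x / ε)) *
    (deriv evenCutoff (planeDist h x / ε) / ε)

/-- The derivative of `planeCutoff`. -/
def planeCutoffDeriv (s : Finset (E × ℝ)) (ε : ℝ) (x : E) : E →L[ℝ] ℝ :=
  ∑ h ∈ s, planeCutoffCoeff s ε h x • innerSL ℝ h.1

theorem hasFDerivAt_planeCutoff (s : Finset (E × ℝ)) (ε : ℝ) (x : E) :
    HasFDerivAt (planeCutoff s ε) (planeCutoffDeriv s ε x) x := by
  classical
  have h1 : ∀ h ∈ s, HasFDerivAt (fun x => evenCutoff (planeDist h x / ε))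
      ((deriv evenCutoff (planeDist h x / ε) / ε) • innerSL ℝ h.1) x := by
    intro h _
    have := (evenCutoff.hasDerivAt (planeDist h x / ε)).comp_hasFDerivAt x
      ((hasFDerivAt_planeDist h x).mul_const ε⁻¹)
    rw [smul_smul] at this
    exact this
  have := HasFDerivAt.finsetProd h1
  unfold planeCutoffDeriv planeCutoffCoeff
  simp only [smul_smul] at this
  exact this

theorem continuous_planeCutoff (s : Finset (E × ℝ)) (ε : ℝ) : Continuous (planeCutoff s ε) := by
  refine continuous_finsetProd _ fun h _ => ?_
  exact evenCutoff.continuous.comp ((continuous_planeDist h).div_const _)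

theorem continuous_planeCutoffCoeff (s : Finset (E × ℝ)) (ε : ℝ) (h : E × ℝ) :
    Continuous (planeCutoffCoeff s ε h) := by
  refine (continuous_finsetProd _ fun h _ => ?_).mul ?_
  · exact evenCutoff.continuous.comp ((continuous_planeDist h).div_const _)
  · exact (evenCutoff.continuous_deriv.comp ((continuous_planeDist h).div_const _)).div_const _

theorem continuous_planeCutoffDeriv (s : Finset (E × ℝ)) (ε : ℝ) :
    Continuous (planeCutoffDeriv s ε) :=
  continuous_finsetSum _ fun h _ => (continuous_planeCutoffCoeff s ε h).smul continuous_const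

theorem planeCutoff_eq_zero {ε : ℝ} (hε : 0 < ε) {x : E} {h : E × ℝ} (hs : h ∈ s)
    (hx : planeDist h x ^ 2 < ε ^ 2) : planeCutoff s ε x = 0 := by
  refine Finset.prod_eq_zero hs (evenCutoff.eq_zero ?_)
  rw [div_pow, div_le_one (by positivity)]
  exact hx.le

theorem planeCutoffDeriv_eq_zero {ε : ℝ} (hε : 0 < ε) {x : E} {h : E × ℝ} (hs : h ∈ s)
    (hx : planeDist h x ^ 2 < ε ^ 2) : planeCutoffDeriv s ε x = 0 := by
  classical
  have hx' : (planeDist h x / ε) ^ 2 < 1 := by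
    rwa [div_pow, div_lt_one (by positivity)]
  refine Finset.sum_eq_zero fun g _ => ?_
  rw [planeCutoffCoeff]
  by_cases hg : g = h
  · rw [hg, evenCutoff.deriv_eq_zero_of_lt hx']; simp
  · rw [Finset.prod_eq_zero (i := h) (Finset.mem_erase.2 ⟨Ne.symm hg, hs⟩)
      (evenCutoff.eq_zero hx'.le)]
    simp

/-- The cutoff at scale `ε / 2` is already `1` wherever the one at scale `ε` can be nonzero, so it
may be inserted there for free. -/
theorem planeCutoff_half_eq_one {ε : ℝ} (hε : 0 < ε) {x : E}
    (hx : ∀ h ∈ s, ε ^ 2 ≤ planeDist h x ^ 2) : planeCutoff s (ε / 2) x = 1 := by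
  refine Finset.prod_eq_one fun h hh => evenCutoff.eq_one ?_
  rw [div_pow, le_div_iff₀ (by positivity)]
  nlinarith [hx h hh]

theorem planeCutoffDeriv_half_eq_zero {ε : ℝ} (hε : 0 < ε) {x : E}
    (hx : ∀ h ∈ s, ε ^ 2 ≤ planeDist h x ^ 2) : planeCutoffDeriv s (ε / 2) x = 0 := by
  refine Finset.sum_eq_zero fun h hh => ?_
  rw [planeCutoffCoeff, evenCutoff.deriv_eq_zero_of_gt]
  · simp
  · rw [div_pow, lt_div_iff₀ (by positivity)]
    nlinarith [hx h hh, sq_pos_of_pos hε]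

theorem planeCutoff_nonneg (s : Finset (E × ℝ)) (ε : ℝ) (x : E) : 0 ≤ planeCutoff s ε x :=
  Finset.prod_nonneg fun _ _ => evenCutoff.nonneg _

theorem planeCutoff_le_one (s : Finset (E × ℝ)) (ε : ℝ) (x : E) : planeCutoff s ε x ≤ 1 :=
  Finset.prod_le_one (fun _ _ => evenCutoff.nonneg _) fun _ _ => evenCutoff.le_one _

theorem evenCutoff_div_eq_one {r δ : ℝ} (hδ : 0 < δ) (hr : δ ≤ |r|) {ε : ℝ}
    (hε : 0 < ε) (hεδ : ε < δ / 2) : evenCutoff (r / ε) = 1 := by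
  apply evenCutoff.eq_one
  rw [div_pow, le_div_iff₀ (by positivity), ← sq_abs r]
  nlinarith

variable {Ω : Set E}

/-- Extension by zero stays differentiable: a boundary point lies on one of the hyperplanes, and the
cutoff vanishes in a neighbourhood of it. -/
theorem hasFDerivAt_indicator_planeCutoff_mul (hΩ : IsOpen Ω)
    (hs : ∀ x ∈ frontier Ω, ∃ h ∈ s, planeDist h x = 0)
    {u : E → ℝ} {u' : E → E →L[ℝ] ℝ} (hu : ∀ x ∈ Ω, HasFDerivAt u (u' x) x)
    {ε : ℝ} (hε : 0 < ε) (x : E) :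
    HasFDerivAt (Ω.indicator fun x => planeCutoff s ε x * u x)
      (Ω.indicator (fun x => planeCutoff s ε x • u' x + u x • planeCutoffDeriv s ε x) x) x := by
  by_cases hx : x ∈ Ω
  · rw [Set.indicator_of_mem hx]
    refine ((hasFDerivAt_planeCutoff s ε x).mul (hu x hx)).congr_of_eventuallyEq ?_
    filter_upwards [hΩ.mem_nhds hx] with y hy
    rw [Set.indicator_of_mem hy]
    rfl
  · rw [Set.indicator_of_notMem hx]
    have : (Ω.indicator fun x => planeCutoff s ε x * u x) =ᶠ[𝓝 x] fun _ => 0 := by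
      by_cases hxc : x ∈ closure Ω
      · obtain ⟨h, hh, h0⟩ := hs x ⟨hxc, by rwa [hΩ.interior_eq]⟩
        have hc : ContinuousAt (fun y => planeDist h y ^ 2) x :=
          ((continuous_planeDist h).pow 2).continuousAt
        have : ∀ᶠ y in 𝓝 x, planeDist h y ^ 2 < ε ^ 2 :=
          hc.eventually_lt continuousAt_const (by rw [h0, zero_pow two_ne_zero]; positivity)
        filter_upwards [this] with y hy
        rw [Set.indicator_apply_eq_zero]
        intro _
        rw [planeCutoff_eq_zero hε hh hy, zero_mul]
      · filter_upwards [isClosed_closure.isOpen_compl.mem_nhds hxc] with y hy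
        exact Set.indicator_of_notMem (fun h => hy (subset_closure h)) _
    exact (hasFDerivAt_const (0 : ℝ) x).congr_of_eventuallyEq this

variable [FiniteDimensional ℝ E]

theorem exists_lipschitzWith_indicator_planeCutoff_mul (hΩ : IsOpen Ω)
    (hb : Bornology.IsBounded Ω)
    (hs : ∀ x ∈ frontier Ω, ∃ h ∈ s, planeDist h x = 0)
    {u : E → ℝ} {u' : E → E →L[ℝ] ℝ} (hu : ∀ x ∈ Ω, HasFDerivAt u (u' x) x)
    (huc : ContinuousOn u (closure Ω)) (huc' : ContinuousOn u' (closure Ω))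
    {ε : ℝ} (hε : 0 < ε) :
    ∃ C, LipschitzWith C (Ω.indicator fun x => planeCutoff s ε x * u x) := by
  have hcomp : IsCompact (closure Ω) := hb.isCompact_closure
  obtain ⟨C, hC⟩ := hcomp.exists_bound_of_continuousOn
    (f := fun x => planeCutoff s ε x • u' x + u x • planeCutoffDeriv s ε x)
    (((continuous_planeCutoff s ε).continuousOn.smul huc').add
      (huc.smul (continuous_planeCutoffDeriv s ε).continuousOn))
  refine ⟨(max C 0).toNNReal, lipschitzWith_of_nnnorm_fderiv_le
    (fun x => (hasFDerivAt_indicator_planeCutoff_mul hΩ hs hu hε x).differentiableAt)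
    fun x => ?_⟩
  rw [(hasFDerivAt_indicator_planeCutoff_mul hΩ hs hu hε x).fderiv, ← NNReal.coe_le_coe, coe_nnnorm,
    Real.coe_toNNReal _ (le_max_right _ _)]
  by_cases hx : x ∈ Ω
  · rw [Set.indicator_of_mem hx]
    exact (hC x (subset_closure hx)).trans (le_max_left _ _)
  · rw [Set.indicator_of_notMem hx, norm_zero]
    exact le_max_right _ _

theorem hasCompactSupport_indicator (hb : Bornology.IsBounded Ω) (u : E → ℝ) :
    HasCompactSupport (Ω.indicator u) :=
  HasCompactSupport.intro hb.isCompact_closure fun _ hx =>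
    Set.indicator_of_notMem (fun h => hx (subset_closure h)) _

variable [MeasurableSpace E] [BorelSpace E]

theorem ContinuousOn.integrableOn_of_isBounded {f : E → ℝ} (hb : Bornology.IsBounded Ω)
    (hf : ContinuousOn f (closure Ω)) : IntegrableOn f Ω :=
  (hf.integrableOn_compact hb.isCompact_closure).mono_set subset_closure

/-- The integral of a Jacobian with a cutoff, expressed by the derivative of the cutoff. -/
theorem setIntegral_planeCutoff_jacobian (hΩ : IsOpen Ω) (hb : Bornology.IsBounded Ω)
    (hs : ∀ x ∈ frontier Ω, ∃ h ∈ s, planeDist h x = 0)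
    {u v : E → ℝ} {u' v' : E → E →L[ℝ] ℝ}
    (hu : ∀ x ∈ Ω, HasFDerivAt u (u' x) x) (hv : ∀ x ∈ Ω, HasFDerivAt v (v' x) x)
    (huc : ContinuousOn u (closure Ω)) (huc' : ContinuousOn u' (closure Ω))
    (hvc : ContinuousOn v (closure Ω)) (hvc' : ContinuousOn v' (closure Ω))
    {ε : ℝ} (hε : 0 < ε) (a b : E) :
    ∫ x in Ω, (planeCutoff s ε x * (u' x a * v' x b - u' x b * v' x a) +
      ∑ h ∈ s, planeCutoffCoeff s ε h x *
        (u x * (inner ℝ h.1 a * v' x b - inner ℝ h.1 b * v' x a))) = 0 := by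
  -- The weak symmetry needs both functions globally Lipschitz with compact support. Cutting `v` off
  -- at the smaller scale achieves this without changing the integrand, since `v` is untouched where
  -- the cutoff of `u` lives.
  have hε2 : 0 < ε / 2 := by positivity
  obtain ⟨C, hC⟩ := exists_lipschitzWith_indicator_planeCutoff_mul hΩ hb hs hu huc huc' hε
  obtain ⟨D, hD⟩ := exists_lipschitzWith_indicator_planeCutoff_mul hΩ hb hs hv hvc hvc' hε2
  have key := integral_fderiv_mul_fderiv_comm (μ := volume)
    hC (hasCompactSupport_indicator hb _) (hasFDerivAt_indicator_planeCutoff_mul hΩ hs hu hε)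
    hD (hasCompactSupport_indicator hb _) (hasFDerivAt_indicator_planeCutoff_mul hΩ hs hv hε2) a b
  have point : ∀ a b : E, ∀ x,
      (Ω.indicator (fun x => planeCutoff s ε x • u' x + u x • planeCutoffDeriv s ε x) x) a *
      (Ω.indicator (fun x => planeCutoff s (ε / 2) x • v' x +
        v x • planeCutoffDeriv s (ε / 2) x) x) b =
      Ω.indicator (fun x => (planeCutoff s ε x * u' x a + u x * planeCutoffDeriv s ε x a) *
        v' x b) x := by
    intro a b x
    by_cases hx : x ∈ Ω
    · simp only [Set.indicator_of_mem hx]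
      by_cases hfar : ∀ h ∈ s, ε ^ 2 ≤ planeDist h x ^ 2
      · rw [planeCutoff_half_eq_one hε hfar, planeCutoffDeriv_half_eq_zero hε hfar]
        simp
      · push Not at hfar
        obtain ⟨h, hh, hlt⟩ := hfar
        rw [planeCutoff_eq_zero hε hh hlt, planeCutoffDeriv_eq_zero hε hh hlt]
        simp
    · simp [Set.indicator_of_notMem hx]
  simp only [point] at key
  rw [integral_indicator hΩ.measurableSet, integral_indicator hΩ.measurableSet, ← sub_eq_zero,
    ← integral_sub] at key
  · rw [← key]
    refine integral_congr_ae (Eventually.of_forall fun x => ?_)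
    simp only [planeCutoffDeriv, sum_apply, smul_apply,
      innerSL_apply_apply, smul_eq_mul]
    have : ∑ h ∈ s, planeCutoffCoeff s ε h x *
        (u x * (inner ℝ h.1 a * v' x b - inner ℝ h.1 b * v' x a)) =
        u x * (∑ h ∈ s, planeCutoffCoeff s ε h x * inner ℝ h.1 a) * v' x b -
        u x * (∑ h ∈ s, planeCutoffCoeff s ε h x * inner ℝ h.1 b) * v' x a := by
      simp only [Finset.mul_sum, Finset.sum_mul, ← Finset.sum_sub_distrib]
      exact Finset.sum_congr rfl fun h _ => by ring
    rw [this]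
    ring
  all_goals
    refine ContinuousOn.integrableOn_of_isBounded hb ?_
    have h1 := (continuous_planeCutoff s ε).continuousOn (s := closure Ω)
    have h2 := (continuous_planeCutoffDeriv s ε).continuousOn (s := closure Ω)
    fun_prop

end PlaneCutoff

/-! ### The two sides of a hyperplane near a boundary or interior point -/

theorem IsPreconnected.subset_or_disjoint_of_disjoint_frontier {X : Type*} [TopologicalSpace X]
    {S U : Set X} (hS : IsPreconnected S) (hU : IsOpen U) (h : ∀ z ∈ S, z ∉ frontier U) :
    S ⊆ U ∨ ∀ z ∈ S, z ∉ U := by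
  have := hS.subset_or_subset hU isClosed_closure.isOpen_compl
    (Set.disjoint_left.2 fun z hz hz' => hz' (subset_closure hz)) fun z hz => by
      by_cases hzU : z ∈ U
      · exact Or.inl hzU
      · exact Or.inr fun hc => h z hz ⟨hc, by rwa [hU.interior_eq]⟩
  exact this.imp id fun h z hz hz' => h hz (subset_closure hz')

namespace Polytopes

variable {n : ℕ} {Ω : Set (EuclideanSpace ℝ (Fin n))}

theorem IsOutwardUnitNormal.mem_frontier {x ν : EuclideanSpace ℝ (Fin n)}
    (h : IsOutwardUnitNormal Ω x ν) : x ∈ frontier Ω := by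
  obtain ⟨hν, r, hr, hball⟩ := h
  constructor
  · rw [mem_closure_iff_frequently]
    have ht : Tendsto (fun c : ℝ => x + (-c) • ν) (𝓝[>] 0) (𝓝 x) := by
      have : Tendsto (fun c : ℝ => x + (-c) • ν) (𝓝 0) (𝓝 (x + (-(0 : ℝ)) • ν)) :=
        Continuous.tendsto (by fun_prop) 0
      simp only [neg_zero, zero_smul, add_zero] at this
      exact this.mono_left nhdsWithin_le_nhds
    refine ht.frequently (Eventually.frequently ?_)
    filter_upwards [ht (Metric.ball_mem_nhds x hr), self_mem_nhdsWithin] with c hc hc0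
    rw [hball _ hc, add_sub_cancel_left, inner_smul_right, real_inner_self_eq_norm_sq, hν]
    have : (0 : ℝ) < c := hc0
    linarith
  · intro hx
    have := (hball x (Metric.mem_ball_self hr)).1 (interior_subset hx)
    simp at this

/-- The two sides of a hyperplane inside a small ball, when the boundary of `Ω` in that ball lies
on the hyperplane: their contributions cancel in the limit, if the (continuous) function `G`
vanishes wherever the hyperplane is the boundary. -/
theorem tendsto_indicator_sub_indicator (hΩ : IsOpen Ω) {h : EuclideanSpace ℝ (Fin n) × ℝ}
    (hh : ‖h.1‖ = 1) {y : EuclideanSpace ℝ (Fin n)} (hy : planeDist h y = 0)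
    {r : ℝ} (hr : 0 < r) (hball : ∀ z ∈ Metric.ball y r, z ∈ frontier Ω → planeDist h z = 0)
    {G : EuclideanSpace ℝ (Fin n) → ℝ} (hG : ContinuousOn G (closure Ω))
    (hG0 : ∀ ν, (ν = h.1 ∨ ν = -h.1) → IsOutwardUnitNormal Ω y ν → G y = 0) :
    Tendsto (fun c : ℝ => Ω.indicator G (y + c • h.1) - Ω.indicator G (y + (-c) • h.1))
      (𝓝[≠] 0) (𝓝 0) := by
  have hinner : ∀ z, planeDist h z = inner ℝ h.1 (z - y) := by
    intro z
    have := planeDist_add h y (z - y)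
    rw [add_sub_cancel, hy, zero_add] at this
    exact this
  have hlin : IsLinearMap ℝ (fun z : EuclideanSpace ℝ (Fin n) => (inner ℝ h.1 z : ℝ)) :=
    (innerSL ℝ h.1).isLinear
  have hplus : Convex ℝ (Metric.ball y r ∩ {z | 0 < planeDist h z}) := by
    refine (convex_ball y r).inter ?_
    convert convex_halfSpace_gt hlin h.2 using 1
    ext z; simp [planeDist]
  have hminus : Convex ℝ (Metric.ball y r ∩ {z | planeDist h z < 0}) := by
    refine (convex_ball y r).inter ?_
    convert convex_halfSpace_lt hlin h.2 using 1
    ext z; simp [planeDist]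
  -- Each open half-ball is convex and misses the frontier, so it lies in `Ω` or outside: four
  -- cases.
  have dplus := hplus.isPreconnected.subset_or_disjoint_of_disjoint_frontier hΩ
    fun z hz hzf => hz.2.ne' (hball z hz.1 hzf)
  have dminus := hminus.isPreconnected.subset_or_disjoint_of_disjoint_frontier hΩ
    fun z hz hzf => hz.2.ne (hball z hz.1 hzf)
  have lin0 : ∀ d : ℝ, Tendsto (fun c : ℝ => y + (d * c) • h.1) (𝓝[≠] 0) (𝓝 y) := by
    intro d
    have : Tendsto (fun c : ℝ => y + (d * c) • h.1) (𝓝 0) (𝓝 (y + (d * (0 : ℝ)) • h.1)) :=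
      Continuous.tendsto (by fun_prop) 0
    simp only [mul_zero, zero_smul, add_zero] at this
    exact this.mono_left nhdsWithin_le_nhds
  have lin1 : Tendsto (fun c : ℝ => y + c • h.1) (𝓝[≠] 0) (𝓝 y) := by simpa using lin0 1
  have lin2 : Tendsto (fun c : ℝ => y + (-c) • h.1) (𝓝[≠] 0) (𝓝 y) := by simpa using lin0 (-1)
  have pd : ∀ c : ℝ, planeDist h (y + c • h.1) = c := by
    intro c
    rw [planeDist_add, hy, inner_smul_right, real_inner_self_eq_norm_sq, hh]; ring
  have hsub : ∀ {F : EuclideanSpace ℝ (Fin n) → ℝ} {c₀ : ℝ},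
      Tendsto F (𝓝[{z | planeDist h z ≠ 0}] y) (𝓝 c₀) →
      Tendsto (fun c : ℝ => F (y + c • h.1) - F (y + (-c) • h.1)) (𝓝[≠] 0) (𝓝 0) := by
    intro F c₀ hF
    have h1 : Tendsto (fun c : ℝ => y + c • h.1) (𝓝[≠] 0) (𝓝[{z | planeDist h z ≠ 0}] y) := by
      refine tendsto_nhdsWithin_iff.2 ⟨lin1, ?_⟩
      filter_upwards [self_mem_nhdsWithin] with c hc
      simpa [pd] using hc
    have h2 : Tendsto (fun c : ℝ => y + (-c) • h.1) (𝓝[≠] 0)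
        (𝓝[{z | planeDist h z ≠ 0}] y) := by
      refine tendsto_nhdsWithin_iff.2 ⟨lin2, ?_⟩
      filter_upwards [self_mem_nhdsWithin] with c hc
      rw [pd]; exact neg_ne_zero.2 hc
    simpa using (hF.comp h1).sub (hF.comp h2)
  have hzero : y ∈ closure Ω → G y = 0 → Tendsto (Ω.indicator G) (𝓝 y) (𝓝 0) := by
    intro hyc hGy
    have hw := (hG y hyc).mono subset_closure
    rw [ContinuousWithinAt, hGy, Metric.tendsto_nhdsWithin_nhds] at hw
    rw [Metric.tendsto_nhds_nhds]
    intro ε hε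
    obtain ⟨δ, hδ, hw⟩ := hw ε hε
    refine ⟨δ, hδ, fun z hz => ?_⟩
    by_cases hzΩ : z ∈ Ω
    · rw [Set.indicator_of_mem hzΩ]; exact hw hzΩ hz
    · rw [Set.indicator_of_notMem hzΩ]; simpa using hε
  -- one side in `Ω`, the other side outside
  have honeside : ∀ σ : ℝ, (σ = 1 ∨ σ = -1) →
      (∀ z ∈ Metric.ball y r, σ * planeDist h z < 0 → z ∈ Ω) →
      (∀ z ∈ Metric.ball y r, 0 < σ * planeDist h z → z ∉ Ω) →
      Tendsto (Ω.indicator G) (𝓝 y) (𝓝 0) := by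
    intro σ hσ hin hout
    have hσ2 : σ * σ = 1 := by rcases hσ with rfl | rfl <;> norm_num
    have hn : IsOutwardUnitNormal Ω y (σ • h.1) := by
      refine ⟨by rw [norm_smul, hh]; rcases hσ with rfl | rfl <;> norm_num, r, hr, fun z hz => ?_⟩
      rw [real_inner_smul_left, ← hinner]
      refine ⟨fun hzΩ => ?_, hin z hz⟩
      rcases lt_trichotomy (σ * planeDist h z) 0 with h0 | h0 | h0
      · exact h0
      -- A point of `Ω` on the hyperplane itself is impossible: by openness `Ω` would reach the
      -- outer side.
      · exfalso
        have ht : Tendsto (fun c : ℝ => z + (c * σ) • h.1) (𝓝[>] 0) (𝓝 z) := by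
          have : Tendsto (fun c : ℝ => z + (c * σ) • h.1) (𝓝 0) (𝓝 (z + ((0 : ℝ) * σ) • h.1)) :=
            Continuous.tendsto (by fun_prop) 0
          simp only [zero_mul, zero_smul, add_zero] at this
          exact this.mono_left nhdsWithin_le_nhds
        obtain ⟨c, hc, hc0⟩ := ((ht.eventually_mem ((hΩ.inter Metric.isOpen_ball).mem_nhds
          ⟨hzΩ, hz⟩)).and self_mem_nhdsWithin).exists
        refine hout _ hc.2 ?_ hc.1
        rw [planeDist_add, inner_smul_right, real_inner_self_eq_norm_sq, hh, mul_add, h0]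
        have : (0 : ℝ) < c := hc0
        have e : σ * (c * σ * 1 ^ 2) = c := by linear_combination c * hσ2
        rw [e, zero_add]; exact this
      · exact absurd hzΩ (hout z hz h0)
    refine hzero hn.mem_frontier.1 (hG0 (σ • h.1) ?_ hn)
    rcases hσ with rfl | rfl
    · left; simp
    · right; simp
  rcases dplus with dp | dp <;> rcases dminus with dm | dm
  · -- both sides in `Ω`
    have hev : ∀ᶠ z in 𝓝[{z | planeDist h z ≠ 0}] y, z ∈ Ω := by
      filter_upwards [self_mem_nhdsWithin,
        mem_nhdsWithin_of_mem_nhds (Metric.ball_mem_nhds y hr)] with z hz hzb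
      rcases lt_or_gt_of_ne (show planeDist h z ≠ 0 from hz) with h0 | h0
      · exact dm ⟨hzb, h0⟩
      · exact dp ⟨hzb, h0⟩
    have hyc : y ∈ closure Ω := by
      rw [mem_closure_iff_frequently]
      refine lin1.frequently (Eventually.frequently ?_)
      filter_upwards [self_mem_nhdsWithin, lin1 (Metric.ball_mem_nhds y hr)] with c hc hcb
      rcases lt_or_gt_of_ne (show c ≠ 0 from hc) with h0 | h0
      · exact dm ⟨hcb, by change planeDist h _ < 0; rwa [pd]⟩
      · exact dp ⟨hcb, by change 0 < planeDist h _; rwa [pd]⟩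
    have hw : Tendsto G (𝓝[Ω] y) (𝓝 (G y)) := (hG y hyc).mono subset_closure
    refine hsub (c₀ := G y) ?_
    have : Tendsto G (𝓝[{z | planeDist h z ≠ 0}] y) (𝓝 (G y)) :=
      hw.comp (tendsto_nhdsWithin_iff.2 ⟨tendsto_id.mono_left nhdsWithin_le_nhds, hev⟩)
    refine this.congr' ?_
    filter_upwards [hev] with z hz
    rw [Set.indicator_of_mem hz]
  · refine hsub ((honeside (-1) (Or.inr rfl) (fun z hz h0 => dp ⟨hz, ?_⟩)
      fun z hz h0 => dm z ⟨hz, ?_⟩).mono_left nhdsWithin_le_nhds)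
    · change 0 < planeDist h z; linarith
    · change planeDist h z < 0; linarith
  · refine hsub ((honeside 1 (Or.inl rfl) (fun z hz h0 => dm ⟨hz, ?_⟩)
      fun z hz h0 => dp z ⟨hz, ?_⟩).mono_left nhdsWithin_le_nhds)
    · change planeDist h z < 0; linarith
    · change 0 < planeDist h z; linarith
  · refine hsub (c₀ := 0) (Tendsto.congr' (f₁ := fun _ => (0 : ℝ)) ?_ tendsto_const_nhds)
    filter_upwards [self_mem_nhdsWithin,
      mem_nhdsWithin_of_mem_nhds (Metric.ball_mem_nhds y hr)] with z hz hzb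
    rw [Set.indicator_of_notMem]
    rcases lt_or_gt_of_ne (show planeDist h z ≠ 0 from hz) with h0 | h0
    · exact dm z ⟨hzb, h0⟩
    · exact dp z ⟨hzb, h0⟩

end Polytopes

/-! ### Limit of the contribution of one hyperplane -/

namespace Polytopes

variable {n : ℕ} {Ω : Set (EuclideanSpace ℝ (Fin n))}
  {s : Finset (EuclideanSpace ℝ (Fin n) × ℝ)}

theorem tendsto_planeDilation {E : Type*} [NormedAddCommGroup E] [InnerProductSpace ℝ E]
    (h : E × ℝ) (x : E) :
    Tendsto (fun c : ℝ => planeDilation h c x) (𝓝 0) (𝓝 (planeDilation h 0 x)) :=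
  Continuous.tendsto (by unfold planeDilation; fun_prop) 0

/-- The expression is affine in `x` and nonzero at `y`, which the dilation with factor `0` fixes; so
its zero set is null. -/
theorem ae_planeDist_planeDilation_ne {h h' : EuclideanSpace ℝ (Fin n) × ℝ}
    (hne : ∃ y, planeDist h y = 0 ∧ planeDist h' y ≠ 0) :
    ∀ᵐ x, planeDist h' (planeDilation h 0 x) ≠ 0 := by
  obtain ⟨y, hy, hy'⟩ := hne
  have e : ∀ x, planeDist h' (planeDilation h 0 x) =
      inner ℝ (h'.1 - (inner ℝ h'.1 h.1 : ℝ) • h.1) x -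
        (h'.2 - (inner ℝ h'.1 h.1 : ℝ) * h.2) := by
    intro x
    rw [planeDilation, planeDist_add, inner_smul_right, inner_sub_left, real_inner_smul_left]
    simp only [planeDist]
    ring
  have hy0 : planeDilation h 0 y = y := by simp [planeDilation, hy]
  have := ae_inner_ne (E := EuclideanSpace ℝ (Fin n))
    (w := h'.1 - (inner ℝ h'.1 h.1 : ℝ) • h.1) (β := h'.2 - (inner ℝ h'.1 h.1 : ℝ) * h.2)
    ⟨y, fun h0 => hy' (by rw [← hy0, e, h0, sub_self])⟩
  filter_upwards [this] with x hx
  rw [e]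
  exact sub_ne_zero.2 hx

theorem measurable_indicator_of_continuousOn {F : EuclideanSpace ℝ (Fin n) → ℝ} (hΩ : IsOpen Ω)
    (hF : ContinuousOn F Ω) : Measurable (Ω.indicator F) := by
  classical
  rw [← Set.piecewise_eq_indicator]
  exact hF.measurable_piecewise continuousOn_const hΩ.measurableSet

/-- The part of the derivative of the cutoff function that is concentrated near one hyperplane
does not contribute in the limit against functions that vanish wherever that hyperplane is the
boundary. -/
theorem tendsto_setIntegral_planeCutoffCoeff_mul (hΩ : IsOpen Ω) (hb : Bornology.IsBounded Ω)
    (hs1 : ∀ h ∈ s, ‖h.1‖ = 1)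
    (hs2 : ∀ h ∈ s, ∀ h' ∈ s, h' ≠ h → ∃ y, planeDist h y = 0 ∧ planeDist h' y ≠ 0)
    (hs : ∀ x ∈ frontier Ω, ∃ h ∈ s, planeDist h x = 0)
    {h : EuclideanSpace ℝ (Fin n) × ℝ} (hh : h ∈ s)
    {G : EuclideanSpace ℝ (Fin n) → ℝ} (hG : ContinuousOn G (closure Ω))
    (hG0 : ∀ y ν, (ν = h.1 ∨ ν = -h.1) → IsOutwardUnitNormal Ω y ν → G y = 0) :
    Tendsto (fun ε => ∫ x in Ω, planeCutoffCoeff s ε h x * G x) (𝓝[>] 0) (𝓝 0) := by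
  classical
  obtain ⟨B, hB⟩ := evenCutoff.exists_abs_deriv_le
  obtain ⟨M, hM⟩ := hb.isCompact_closure.exists_bound_of_continuousOn hG
  obtain ⟨R, hR⟩ := hb.subset_closedBall 0
  have hB0 : 0 ≤ B := (abs_nonneg _).trans (hB 0)
  set P : ℝ → EuclideanSpace ℝ (Fin n) → ℝ := fun ε x =>
    ∏ h' ∈ s.erase h, evenCutoff (planeDist h' x / ε) with hP
  set H : ℝ → EuclideanSpace ℝ (Fin n) → ℝ := fun ε => Ω.indicator fun x => P ε x * G x with hH
  have hPc : ∀ ε, Continuous (P ε) := fun ε => continuous_finsetProd _ fun h _ =>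
    evenCutoff.continuous.comp ((continuous_planeDist h).div_const _)
  have hP1 : ∀ ε x, |P ε x| ≤ 1 := fun ε x => by
    rw [abs_of_nonneg (Finset.prod_nonneg fun _ _ => evenCutoff.nonneg _)]
    exact Finset.prod_le_one (fun _ _ => evenCutoff.nonneg _) fun _ _ => evenCutoff.le_one _
  have hHm : ∀ ε, Measurable (H ε) := fun ε =>
    measurable_indicator_of_continuousOn hΩ ((hPc ε).continuousOn.mul (hG.mono subset_closure))
  have hHb : ∀ ε x, |H ε x| ≤ max M 0 := by
    intro ε x
    by_cases hx : x ∈ Ω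
    · rw [hH]
      simp only [Set.indicator_of_mem hx, abs_mul]
      calc |P ε x| * |G x| ≤ 1 * |G x| := by gcongr; exact hP1 ε x
        _ ≤ M := by rw [one_mul]; exact hM x (subset_closure hx)
        _ ≤ max M 0 := le_max_left _ _
    · rw [hH]
      simp [Set.indicator_of_notMem hx]
  -- Where the derivative of the cutoff is nonzero, `|planeDist h x| ≤ 2`, and `|c - 1| ≤ 2`; the
  -- dilation therefore moves `x` by at most `4`, whence the radius `R + 4`.
  have hbound : ∀ ε c, |c| ≤ 1 → ∀ x,
      |deriv evenCutoff (planeDist h x) * H ε (planeDilation h c x)| ≤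
        (Metric.closedBall (0 : EuclideanSpace ℝ (Fin n)) (R + 4)).indicator
          (fun _ => B * max M 0) x := by
    intro ε c hc x
    by_cases hx : x ∈ Metric.closedBall (0 : EuclideanSpace ℝ (Fin n)) (R + 4)
    · rw [Set.indicator_of_mem hx, abs_mul]
      exact mul_le_mul (hB _) (hHb _ _) (abs_nonneg _) hB0
    · rw [Set.indicator_of_notMem hx]
      by_cases hpd : 2 < planeDist h x ^ 2
      · rw [evenCutoff.deriv_eq_zero_of_gt hpd]; simp
      · have hnot : planeDilation h c x ∉ Ω := by
          intro hmem
          apply hx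
          have h1 := hR hmem
          rw [mem_closedBall_zero_iff] at h1 ⊢
          have h2 : |planeDist h x| ≤ 2 := by
            push Not at hpd
            exact abs_le_of_sq_le_sq (by linarith) (by norm_num)
          have h3 : |c - 1| ≤ 2 := by
            rw [abs_le] at hc ⊢
            constructor <;> linarith
          have h4 : x = planeDilation h c x - ((c - 1) * planeDist h x) • h.1 := by
            rw [planeDilation, add_sub_cancel_right]
          have h5 : ‖((c - 1) * planeDist h x) • h.1‖ ≤ 4 := by
            rw [norm_smul, hs1 h hh, mul_one, Real.norm_eq_abs, abs_mul]
            nlinarith [abs_nonneg (c - 1), abs_nonneg (planeDist h x)]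
          rw [h4]
          exact (norm_sub_le _ _).trans (add_le_add h1 h5)
        rw [hH]
        simp [Set.indicator_of_notMem hnot]
  have hmeas : ∀ ε c, Measurable fun x =>
      deriv evenCutoff (planeDist h x) * H ε (planeDilation h c x) := fun ε c =>
    (evenCutoff.continuous_deriv.comp (continuous_planeDist h)).measurable.mul
      ((hHm ε).comp (continuous_planeDilation h c).measurable)
  have hdom : Integrable ((Metric.closedBall (0 : EuclideanSpace ℝ (Fin n)) (R + 4)).indicator
      (fun _ => B * max M 0)) := by
    rw [integrable_indicator_iff Metric.isClosed_closedBall.measurableSet]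
    exact continuousOn_const.integrableOn_compact (isCompact_closedBall _ _)
  have hint : ∀ ε c, |c| ≤ 1 → Integrable fun x =>
      deriv evenCutoff (planeDist h x) * H ε (planeDilation h c x) := fun ε c hc =>
    hdom.mono' (hmeas ε c).aestronglyMeasurable (Eventually.of_forall (hbound ε c hc))
  have hI : ∀ ε, ∫ x in Ω, planeCutoffCoeff s ε h x * G x =
      ∫ x, deriv evenCutoff (planeDist h x / ε) / ε * H ε x := by
    intro ε
    rw [← integral_indicator hΩ.measurableSet]
    congr 1
    ext x
    by_cases hx : x ∈ Ω
    · simp only [hH, Set.indicator_of_mem hx, hP, planeCutoffCoeff]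
      rw [mul_comm (Finset.prod _ _), mul_assoc]
      congr!
    · simp [hH, Set.indicator_of_notMem hx]
  -- Rescaling by `σε` normal to the hyperplane absorbs the singular factor `1/ε` in the Jacobian.
  -- Averaging over `σ = 1` and `σ = -1` then produces, by oddness, a difference of values at mirror
  -- points.
  have hscale : ∀ ε > 0, ∀ σ : ℝ, |σ| = 1 →
      ∫ x, deriv evenCutoff (planeDist h x / ε) / ε * H ε x =
      ∫ x, deriv evenCutoff (σ * planeDist h x) * H ε (planeDilation h (σ * ε) x) := by
    intro ε hε σ hσ
    have hσ0 : σ ≠ 0 := by intro h0; rw [h0] at hσ; simp at hσ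
    have := integral_comp_planeDilation (hs1 h hh) (c := σ * ε) (mul_ne_zero hσ0 hε.ne')
      fun x => deriv evenCutoff (planeDist h x / ε) / ε * H ε x
    rw [abs_mul, hσ, one_mul, abs_of_pos hε, eq_inv_mul_iff_mul_eq₀ hε.ne',
      ← integral_const_mul] at this
    rw [← this]
    congr 1
    ext x
    rw [planeDist_planeDilation (hs1 h hh),
      show σ * ε * planeDist h x / ε = σ * planeDist h x by field_simp]
    field_simp
  have hsym : ∀ ε > 0, ε ≤ 1 → ∫ x in Ω, planeCutoffCoeff s ε h x * G x =
      (1 / 2) * ∫ x, deriv evenCutoff (planeDist h x) *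
        (H ε (planeDilation h ε x) - H ε (planeDilation h (-ε) x)) := by
    intro ε hε hε1
    have e1 := hscale ε hε 1 (by simp)
    have e2 := hscale ε hε (-1) (by simp)
    simp only [one_mul, neg_mul, evenCutoff.deriv_neg, integral_neg] at e1 e2
    simp only [mul_sub]
    have habs : |ε| ≤ 1 := by rwa [abs_of_pos hε]
    rw [integral_sub (hint ε ε habs) (hint ε (-ε) (by rwa [abs_neg])), hI]
    linarith
  have hlim : Tendsto (fun ε => ∫ x, deriv evenCutoff (planeDist h x) *
        (H ε (planeDilation h ε x) - H ε (planeDilation h (-ε) x))) (𝓝[>] 0)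
      (𝓝 (∫ _ : EuclideanSpace ℝ (Fin n), (0 : ℝ))) := by
    have hsmall : ∀ᶠ ε : ℝ in 𝓝[>] 0, |ε| ≤ 1 := by
      filter_upwards [Ioc_mem_nhdsGT zero_lt_one] with ε hε
      rw [abs_of_pos hε.1]; exact hε.2
    refine tendsto_integral_filter_of_dominated_convergence
      (fun x => 2 * (Metric.closedBall (0 : EuclideanSpace ℝ (Fin n)) (R + 4)).indicator
          (fun _ => B * max M 0) x) ?_ ?_ (hdom.const_mul 2) ?_
    · refine Eventually.of_forall fun ε => ?_
      simp only [mul_sub]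
      exact ((hmeas ε ε).sub (hmeas ε (-ε))).aestronglyMeasurable
    · filter_upwards [hsmall] with ε hε
      refine Eventually.of_forall fun x => ?_
      rw [mul_sub, two_mul]
      exact (norm_sub_le _ _).trans (add_le_add (hbound ε ε hε x)
        (hbound ε (-ε) (by rwa [abs_neg]) x))
    -- For almost every `x` the projection to the hyperplane avoids all the others. Near it the
    -- remaining cutoff factors are eventually `1`, and the frontier can only lie on this
    -- hyperplane.
    · have hae : ∀ᵐ x, ∀ h' ∈ s.erase h, planeDist h' (planeDilation h 0 x) ≠ 0 := by
        rw [Finset.eventually_all]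
        intro h' hh'
        exact ae_planeDist_planeDilation_ne
          (hs2 h hh h' (Finset.mem_of_mem_erase hh') (Finset.ne_of_mem_erase hh'))
      filter_upwards [hae] with x hx
      by_cases hx0 : planeDist h x = 0
      · have : ∀ c, planeDilation h c x = x := fun c => by simp [planeDilation, hx0]
        simp [this]
      set y := planeDilation h 0 x with hy
      have hy0 : planeDist h y = 0 := by
        rw [hy, planeDist_planeDilation (hs1 h hh), zero_mul]
      -- near `y`, no other hyperplane
      obtain ⟨δ, hδ, hδ'⟩ : ∃ δ > 0, ∀ h' ∈ s.erase h, δ ≤ |planeDist h' y| / 2 := by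
        by_cases hemp : (s.erase h).Nonempty
        · obtain ⟨g, hg, hmin⟩ := (s.erase h).exists_min_image (fun h' => |planeDist h' y| / 2) hemp
          exact ⟨|planeDist g y| / 2, by have := abs_pos.2 (hx g hg); positivity, hmin⟩
        · refine ⟨1, one_pos, fun h' hh' => absurd ⟨h', hh'⟩ hemp⟩
      have hnear : ∀ᶠ z in 𝓝 y, ∀ h' ∈ s.erase h, δ ≤ |planeDist h' z| := by
        rw [Filter.eventually_all_finset]
        intro h' hh'
        have hc : ContinuousAt (fun z => |planeDist h' z|) y :=
          (continuous_planeDist h').abs.continuousAt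
        refine (continuousAt_const.eventually_lt hc ?_).mono fun _ h => le_of_lt h
        have := hδ' h' hh'
        linarith
      obtain ⟨r, hr, hball⟩ := Metric.eventually_nhds_iff_ball.1 hnear
      have hside := tendsto_indicator_sub_indicator hΩ (hs1 h hh) hy0 hr (fun z hz hzf => by
        obtain ⟨h', hh', h0⟩ := hs z hzf
        by_cases he : h' = h
        · rwa [← he]
        · have := hball z hz h' (Finset.mem_erase.2 ⟨he, hh'⟩)
          rw [h0, abs_zero] at this
          linarith) hG (hG0 y)
      have hcomp : Tendsto (fun ε : ℝ => ε * planeDist h x) (𝓝[>] 0) (𝓝[≠] 0) := by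
        refine tendsto_nhdsWithin_iff.2 ⟨?_, ?_⟩
        · have : Tendsto (fun ε : ℝ => ε * planeDist h x) (𝓝 0) (𝓝 (0 * planeDist h x)) :=
            Continuous.tendsto (by fun_prop) 0
          rw [zero_mul] at this
          exact this.mono_left nhdsWithin_le_nhds
        · filter_upwards [self_mem_nhdsWithin] with ε hε
          exact mul_ne_zero (ne_of_gt hε) hx0
      have hlim := (hside.comp hcomp).const_mul (deriv evenCutoff (planeDist h x))
      rw [mul_zero] at hlim
      refine hlim.congr' ?_
      have t1 : Tendsto (fun ε : ℝ => planeDilation h ε x) (𝓝[>] 0) (𝓝 y) :=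
        (tendsto_planeDilation h x).mono_left nhdsWithin_le_nhds
      have t2 : Tendsto (fun ε : ℝ => planeDilation h (-ε) x) (𝓝[>] 0) (𝓝 y) := by
        have : Tendsto (fun ε : ℝ => -ε) (𝓝[>] 0) (𝓝 0) := by
          have : Tendsto (fun ε : ℝ => -ε) (𝓝 0) (𝓝 (-0)) := Continuous.tendsto (by fun_prop) 0
          rw [neg_zero] at this
          exact this.mono_left nhdsWithin_le_nhds
        exact (tendsto_planeDilation h x).comp this
      filter_upwards [t1.eventually hnear, t2.eventually hnear,
        Ioo_mem_nhdsGT (show (0 : ℝ) < δ / 2 by positivity)] with ε n1 n2 hε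
      have hHG : ∀ z, (∀ h' ∈ s.erase h, δ ≤ |planeDist h' z|) → H ε z = Ω.indicator G z := by
        intro z hz
        have : P ε z = 1 := Finset.prod_eq_one fun h' hh' =>
          evenCutoff_div_eq_one hδ (hz h' hh') hε.1 hε.2
        by_cases hzΩ : z ∈ Ω
        · simp only [hH, Set.indicator_of_mem hzΩ, this, one_mul]
        · simp only [hH, Set.indicator_of_notMem hzΩ]
      rw [hHG _ n1, hHG _ n2, planeDilation_eq h ε, planeDilation_eq h (-ε)]
      simp only [Function.comp_apply, neg_mul, hy]
  rw [integral_zero] at hlim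
  have := hlim.const_mul (1 / 2)
  rw [mul_zero] at this
  refine this.congr' ?_
  filter_upwards [Ioc_mem_nhdsGT zero_lt_one] with ε hε
  exact (hsym ε hε.1 hε.2).symm

end Polytopes

/-! ### Tangential differentiation of the boundary condition -/

namespace Polytopes

variable {n : ℕ} {Ω : Set (EuclideanSpace ℝ (Fin n))}
  {s : Finset (EuclideanSpace ℝ (Fin n) × ℝ)}

theorem IsOutwardUnitNormal.eventually_add_smul {y ν t : EuclideanSpace ℝ (Fin n)}
    (hy : IsOutwardUnitNormal Ω y ν) (ht : inner ℝ ν t = 0) :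
    ∀ᶠ τ : ℝ in 𝓝 0, IsOutwardUnitNormal Ω (y + τ • t) ν := by
  obtain ⟨hν, r, hr, hball⟩ := hy
  have hc : Tendsto (fun τ : ℝ => y + τ • t) (𝓝 0) (𝓝 y) := by
    have : Tendsto (fun τ : ℝ => y + τ • t) (𝓝 0) (𝓝 (y + (0 : ℝ) • t)) :=
      Continuous.tendsto (by fun_prop) 0
    simpa using this
  filter_upwards [hc (Metric.ball_mem_nhds y hr)] with τ hτ
  obtain ⟨r', hr', hsub⟩ := Metric.isOpen_ball.mem_nhds hτ |> Metric.mem_nhds_iff.1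
  refine ⟨hν, r', hr', fun z hz => ?_⟩
  rw [hball z (hsub hz), ← sub_sub, inner_sub_right ν (z - y), inner_smul_right, ht, mul_zero,
    sub_zero]

/-- If a linear image of a `C¹` function vanishes on a flat part of the boundary, then so does the
same linear image of its tangential derivatives. -/
theorem map_tangential_deriv_eq_zero {V F : Type*} [NormedAddCommGroup V] [NormedSpace ℝ V]
    [NormedAddCommGroup F] [NormedSpace ℝ F] {u : EuclideanSpace ℝ (Fin n) → V}
    {D : EuclideanSpace ℝ (Fin n) → EuclideanSpace ℝ (Fin n) →L[ℝ] V}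
    (hu : ContinuousOn u (closure Ω)) (hD : ContinuousOn D (closure Ω))
    (huD : ∀ x ∈ Ω, HasFDerivAt u (D x) x) (T : V →L[ℝ] F) {y ν : EuclideanSpace ℝ (Fin n)}
    (hy : IsOutwardUnitNormal Ω y ν) (hT : ∀ z, IsOutwardUnitNormal Ω z ν → T (u z) = 0)
    {t : EuclideanSpace ℝ (Fin n)} (ht : inner ℝ ν t = 0) : T (D y t) = 0 := by
  have hnear := hy.eventually_add_smul ht
  have hyf := hy.mem_frontier
  obtain ⟨hν, r, hr, hball⟩ := hy
  set S := Metric.ball y r ∩ {z | inner ℝ ν z < inner ℝ ν y} with hS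
  have hSΩ : S = Metric.ball y r ∩ Ω := by
    ext z
    constructor
    · rintro ⟨hz, h0⟩
      refine ⟨hz, (hball z hz).2 ?_⟩
      rw [inner_sub_right]; exact sub_neg.2 h0
    · rintro ⟨hz, h0⟩
      have := (hball z hz).1 h0
      rw [inner_sub_right] at this
      exact ⟨hz, sub_neg.1 this⟩
  have hsub : S ⊆ Ω := hSΩ ▸ Set.inter_subset_right
  have hopen : IsOpen S := Metric.isOpen_ball.inter (isOpen_lt (by fun_prop) continuous_const)
  have hconv : Convex ℝ S := (convex_ball y r).inter
    (convex_halfSpace_lt (innerSL ℝ ν).isLinear _)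
  -- On the convex half-ball `S` the continuous extension of the derivative is a one-sided
  -- derivative at `y`. The tangential segment through `y` stays in `closure S`, so the chain rule
  -- applies along it.
  have hder : HasFDerivWithinAt u (D y) (closure S) y := by
    refine hasFDerivWithinAt_closure_of_tendsto_fderiv
      (fun z hz => (huD z (hsub hz)).differentiableAt.differentiableWithinAt) hconv hopen
      (fun z hz => (hu z (closure_mono hsub hz)).mono (hsub.trans subset_closure)) ?_
    have h1 : Tendsto D (𝓝[S] y) (𝓝 (D y)) := (hD y hyf.1).mono (hsub.trans subset_closure)
    refine h1.congr' ?_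
    filter_upwards [self_mem_nhdsWithin] with z hz
    exact (huD z (hsub hz)).fderiv.symm
  have hline : HasDerivAt (fun τ : ℝ => y + τ • t) t 0 := by
    simpa using ((hasDerivAt_id (0 : ℝ)).smul_const t).const_add y
  have hev : ∀ᶠ τ : ℝ in 𝓝 0, y + τ • t ∈ closure S ∧ T (u (y + τ • t)) = 0 := by
    have hc : Tendsto (fun τ : ℝ => y + τ • t) (𝓝 0) (𝓝 y) := by
      have := hline.continuousAt.tendsto
      simpa using this
    filter_upwards [hnear, hc (Metric.ball_mem_nhds y hr)] with τ h1 h2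
    refine ⟨?_, hT _ h1⟩
    rw [hSΩ]
    exact Metric.isOpen_ball.inter_closure ⟨h2, h1.mem_frontier.1⟩
  have hcomp : HasDerivWithinAt (fun τ : ℝ => T (u (y + τ • t))) (T (D y t))
      {τ | y + τ • t ∈ closure S} 0 := by
    have h1 : HasFDerivWithinAt u (D y) (closure S) (y + (0 : ℝ) • t) := by simpa using hder
    have h2 := h1.comp_hasDerivWithinAt (0 : ℝ) (hline.hasDerivWithinAt
      (s := {τ | y + τ • t ∈ closure S})) fun τ hτ => hτ
    exact T.hasFDerivAt.comp_hasDerivWithinAt (0 : ℝ) h2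
  have hd := hcomp.hasDerivAt (hev.mono fun _ h => h.1)
  exact hd.unique ((hasDerivAt_const (0 : ℝ) (0 : F)).congr_of_eventuallyEq
    (hev.mono fun _ h => h.2))

end Polytopes

/-! ### Continuity of the integrands -/

namespace KForm

variable {n k : ℕ}

theorem continuous_normSq : Continuous (normSq : KForm n k → ℝ) := by
  have : (normSq : KForm n k → ℝ) = fun α => ∑ I : Fin k ↪o Fin n, componentL I α ^ 2 := rfl
  rw [this]
  fun_prop

theorem continuousOn_ip {X : Type*} [TopologicalSpace X] {S : Set X} {f g : X → KForm n k}
    (hf : ContinuousOn f S) (hg : ContinuousOn g S) : ContinuousOn (fun x => ip (f x) (g x)) S := by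
  have : (fun x => ip (f x) (g x)) = fun x => (k.factorial : ℝ)⁻¹ *
    ∑ I, componentL I (f x) * componentL I (g x) := rfl
  rw [this]
  fun_prop

theorem continuousOn_sum_interiorProd {X : Type*} [TopologicalSpace X] {S : Set X}
    {D : X → EuclideanSpace ℝ (Fin n) →L[ℝ] KForm n k} (hD : ContinuousOn D S) :
    ContinuousOn (fun x => ∑ j, interiorProd (basisVec j) (D x (basisVec j))) S := by
  cases k with
  | zero => simpa [interiorProd] using continuousOn_const
  | succ k =>
    refine continuousOn_finsetSum _ fun j _ => ?_
    exact (contractL (basisVec j)).continuous.comp_continuousOn (hD.clm_apply continuousOn_const)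

theorem flux_eq_sum (a : EuclideanSpace ℝ (Fin n)) (α : KForm n (k + 1))
    (L : EuclideanSpace ℝ (Fin n) →L[ℝ] KForm n (k + 1)) :
    flux a α L = ∑ i, ∑ j,
      (a i * ip (α.curryLeft (basisVec i)) ((L (basisVec j)).curryLeft (basisVec j)) -
        a j * ip (α.curryLeft (basisVec i)) ((L (basisVec i)).curryLeft (basisVec j))) := by
  have h1 : ∀ γ : KForm n (k + 1), γ.curryLeft a = ∑ i, a i • γ.curryLeft (basisVec i) := by
    intro γ
    conv_lhs => rw [← sum_smul_basisVec a]
    simp only [map_sum, map_smul]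
  rw [flux]
  simp only [h1, map_sum, map_smul, LinearMap.sum_apply, LinearMap.smul_apply, smul_eq_mul,
    Finset.sum_sub_distrib]
  congr 1
  exact Finset.sum_comm

theorem continuousOn_flux {S : Set (EuclideanSpace ℝ (Fin n))} (a : EuclideanSpace ℝ (Fin n))
    {ω : EuclideanSpace ℝ (Fin n) → KForm n (k + 1)}
    {D : EuclideanSpace ℝ (Fin n) → EuclideanSpace ℝ (Fin n) →L[ℝ] KForm n (k + 1)}
    (hω : ContinuousOn ω S) (hD : ContinuousOn D S) :
    ContinuousOn (fun x => flux a (ω x) (D x)) S := by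
  refine ContinuousOn.sub (continuousOn_finsetSum _ fun j _ => ?_)
    (continuousOn_finsetSum _ fun j _ => ?_)
  · exact continuousOn_ip ((contractL a).continuous.comp_continuousOn hω)
      ((contractL (basisVec j)).continuous.comp_continuousOn (hD.clm_apply continuousOn_const))
  · exact continuousOn_ip ((contractL (basisVec j)).continuous.comp_continuousOn hω)
      ((contractL a).continuous.comp_continuousOn (hD.clm_apply continuousOn_const))

end KForm

/-! ### The integrated identity with cutoff -/

namespace KForm

variable {n k : ℕ} {Ω : Set (EuclideanSpace ℝ (Fin n))}
  {s : Finset (EuclideanSpace ℝ (Fin n) × ℝ)}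

/-- The difference `|dω|² + |δω|² - |∇ω|²`, where `L` is the derivative of `ω`. -/
def gaffneyDefect (L : EuclideanSpace ℝ (Fin n) →L[ℝ] KForm n (k + 1)) : ℝ :=
  ∑ i, ∑ j, (ip ((L (basisVec i)).curryLeft (basisVec i))
      ((L (basisVec j)).curryLeft (basisVec j)) -
    ip ((L (basisVec i)).curryLeft (basisVec j)) ((L (basisVec j)).curryLeft (basisVec i)))

theorem continuousOn_gaffneyDefect {S : Set (EuclideanSpace ℝ (Fin n))}
    {D : EuclideanSpace ℝ (Fin n) → EuclideanSpace ℝ (Fin n) →L[ℝ] KForm n (k + 1)}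
    (hD : ContinuousOn D S) : ContinuousOn (fun x => gaffneyDefect (D x)) S := by
  have h : ∀ i j : Fin n, ContinuousOn (fun x => (D x (basisVec i)).curryLeft (basisVec j)) S :=
    fun i j => (contractL (basisVec j)).continuous.comp_continuousOn
      (hD.clm_apply continuousOn_const)
  exact continuousOn_finsetSum _ fun i _ => continuousOn_finsetSum _ fun j _ =>
    (continuousOn_ip (h i i) (h j j)).sub (continuousOn_ip (h i j) (h j i))

/-- Integration of the defect against a cutoff function gives the flux through the hyperplanes. -/
theorem setIntegral_planeCutoff_gaffneyDefect (hΩ : IsOpen Ω) (hb : Bornology.IsBounded Ω)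
    (hs : ∀ x ∈ frontier Ω, ∃ h ∈ s, planeDist h x = 0)
    {ω : EuclideanSpace ℝ (Fin n) → KForm n (k + 1)}
    {D : EuclideanSpace ℝ (Fin n) → EuclideanSpace ℝ (Fin n) →L[ℝ] KForm n (k + 1)}
    (hω : ContinuousOn ω (closure Ω)) (hD : ContinuousOn D (closure Ω))
    (hωD : ∀ x ∈ Ω, HasFDerivAt ω (D x) x) {ε : ℝ} (hε : 0 < ε) :
    ∫ x in Ω, (planeCutoff s ε x * gaffneyDefect (D x) +
      ∑ h ∈ s, planeCutoffCoeff s ε h x * flux h.1 (ω x) (D x)) = 0 := by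
  -- `A i I` reads off the component `ω^{iI}`. The defect is, up to `1/k!`, the sum over `i`, `j`,
  -- `I` of the Jacobians of `ω^{iI}` and `ω^{jI}` in the directions `e_i`, `e_j`.
  let A : Fin n → (Fin k → Fin n) → KForm n (k + 1) →L[ℝ] ℝ := fun i I =>
    (componentL I).comp (contractL (basisVec i))
  let f : Fin n → Fin n → (Fin k → Fin n) → EuclideanSpace ℝ (Fin n) → ℝ := fun i j I x =>
    planeCutoff s ε x * (A i I (D x (basisVec i)) * A j I (D x (basisVec j)) -
        A i I (D x (basisVec j)) * A j I (D x (basisVec i))) +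
      ∑ h ∈ s, planeCutoffCoeff s ε h x *
        (A i I (ω x) * (inner ℝ h.1 (basisVec i) * A j I (D x (basisVec j)) -
          inner ℝ h.1 (basisVec j) * A j I (D x (basisVec i))))
  have hf0 : ∀ i j I, ∫ x in Ω, f i j I x = 0 := fun i j I =>
    setIntegral_planeCutoff_jacobian hΩ hb hs
      (u := fun x => A i I (ω x)) (v := fun x => A j I (ω x))
      (u' := fun x => (A i I).comp (D x)) (v' := fun x => (A j I).comp (D x))
      (fun x hx => (A i I).hasFDerivAt.comp x (hωD x hx))
      (fun x hx => (A j I).hasFDerivAt.comp x (hωD x hx))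
      ((A i I).continuous.comp_continuousOn hω) (continuousOn_const.clm_comp hD)
      ((A j I).continuous.comp_continuousOn hω) (continuousOn_const.clm_comp hD) hε _ _
  have hfint : ∀ i j I, IntegrableOn (f i j I) Ω := by
    intro i j I
    refine ContinuousOn.integrableOn_of_isBounded hb ?_
    have h1 := (continuous_planeCutoff s ε).continuousOn (s := closure Ω)
    have h2 := fun h => (continuous_planeCutoffCoeff s ε h).continuousOn (s := closure Ω)
    fun_prop
  have hpoint : ∀ x, planeCutoff s ε x * gaffneyDefect (D x) +
      ∑ h ∈ s, planeCutoffCoeff s ε h x * flux h.1 (ω x) (D x) =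
      (k.factorial : ℝ)⁻¹ * ∑ i, ∑ j, ∑ I, f i j I x := by
    intro x
    have hI : ∀ i j (α β : KForm n (k + 1)), (k.factorial : ℝ)⁻¹ * ∑ I, A i I α * A j I β =
        ip (α.curryLeft (basisVec i)) (β.curryLeft (basisVec j)) := fun i j α β => rfl
    have hij : ∀ i j, (k.factorial : ℝ)⁻¹ * ∑ I, f i j I x =
        planeCutoff s ε x * (ip ((D x (basisVec i)).curryLeft (basisVec i))
          ((D x (basisVec j)).curryLeft (basisVec j)) -
        ip ((D x (basisVec j)).curryLeft (basisVec i))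
          ((D x (basisVec i)).curryLeft (basisVec j))) +
        ∑ h ∈ s, planeCutoffCoeff s ε h x *
        (h.1 i * ip ((ω x).curryLeft (basisVec i)) ((D x (basisVec j)).curryLeft (basisVec j)) -
        h.1 j * ip ((ω x).curryLeft (basisVec i))
          ((D x (basisVec i)).curryLeft (basisVec j))) := by
      intro i j
      simp only [← hI, f, Finset.sum_add_distrib, mul_add, inner_basisVec]
      congr 1
      · simp only [Finset.mul_sum, ← Finset.sum_sub_distrib]
        exact Finset.sum_congr rfl fun I _ => by ring
      · rw [Finset.sum_comm, Finset.mul_sum]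
        refine Finset.sum_congr rfl fun h _ => ?_
        simp only [Finset.mul_sum, ← Finset.sum_sub_distrib]
        exact Finset.sum_congr rfl fun I _ => by ring
    rw [Finset.mul_sum]
    simp only [Finset.mul_sum _ _ (k.factorial : ℝ)⁻¹] at hij ⊢
    simp only [hij, Finset.sum_add_distrib]
    congr 1
    · rw [gaffneyDefect, Finset.mul_sum]
      refine Finset.sum_congr rfl fun i _ => ?_
      rw [Finset.mul_sum]
      refine Finset.sum_congr rfl fun j _ => ?_
      rw [ip_comm ((D x (basisVec j)).curryLeft (basisVec i))]
    · have : ∀ i, ∑ j, ∑ h ∈ s, planeCutoffCoeff s ε h x *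
        (h.1 i * ip ((ω x).curryLeft (basisVec i)) ((D x (basisVec j)).curryLeft (basisVec j)) -
        h.1 j * ip ((ω x).curryLeft (basisVec i)) ((D x (basisVec i)).curryLeft (basisVec j))) =
          ∑ h ∈ s, planeCutoffCoeff s ε h x * ∑ j,
        (h.1 i * ip ((ω x).curryLeft (basisVec i)) ((D x (basisVec j)).curryLeft (basisVec j)) -
        h.1 j * ip ((ω x).curryLeft (basisVec i))
          ((D x (basisVec i)).curryLeft (basisVec j))) := by
        intro i
        rw [Finset.sum_comm]
        exact Finset.sum_congr rfl fun h _ => (Finset.mul_sum _ _ _).symm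
      simp only [this]
      rw [Finset.sum_comm]
      refine Finset.sum_congr rfl fun h _ => ?_
      rw [flux_eq_sum, Finset.mul_sum]
  simp only [hpoint]
  rw [integral_const_mul, integral_finsetSum _ fun i _ => integrable_finsetSum _ fun j _ =>
    integrable_finsetSum _ fun I _ => hfint i j I]
  have h0 : ∀ i, ∫ x in Ω, ∑ j, ∑ I, f i j I x = 0 := by
    intro i
    rw [integral_finsetSum _ fun j _ => integrable_finsetSum _ fun I _ => hfint i j I]
    refine Finset.sum_eq_zero fun j _ => ?_
    rw [integral_finsetSum _ fun I _ => hfint i j I]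
    exact Finset.sum_eq_zero fun I _ => hf0 i j I
  simp [h0]

theorem ae_planeDist_ne_zero (hs1 : ∀ h ∈ s, ‖h.1‖ = 1) :
    ∀ᵐ x : EuclideanSpace ℝ (Fin n), ∀ h ∈ s, planeDist h x ≠ 0 := by
  rw [Finset.eventually_all]
  intro h hh
  have := ae_inner_ne (E := EuclideanSpace ℝ (Fin n)) (w := h.1) (β := h.2)
    ⟨(h.2 + 1) • h.1, by
      rw [inner_smul_right, real_inner_self_eq_norm_sq, hs1 h hh]; simp⟩
  filter_upwards [this] with x hx
  exact sub_ne_zero.2 hx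

/-- Dominated convergence: the cutoffs lie in `[0, 1]` and are eventually `1` at every point off the
hyperplanes, which form a null set. -/
theorem tendsto_setIntegral_planeCutoff_mul (hb : Bornology.IsBounded Ω)
    (hs1 : ∀ h ∈ s, ‖h.1‖ = 1) {Q : EuclideanSpace ℝ (Fin n) → ℝ}
    (hQ : ContinuousOn Q (closure Ω)) :
    Tendsto (fun ε => ∫ x in Ω, planeCutoff s ε x * Q x) (𝓝[>] 0) (𝓝 (∫ x in Ω, Q x)) := by
  have hQint := ContinuousOn.integrableOn_of_isBounded hb hQ
  refine tendsto_integral_filter_of_dominated_convergence (fun x => ‖Q x‖) ?_ ?_ hQint.norm ?_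
  · exact Eventually.of_forall fun ε =>
      (continuous_planeCutoff s ε).aestronglyMeasurable.mul hQint.aestronglyMeasurable
  · refine Eventually.of_forall fun ε => Eventually.of_forall fun x => ?_
    rw [norm_mul, Real.norm_eq_abs, abs_of_nonneg (planeCutoff_nonneg s ε x)]
    exact mul_le_of_le_one_left (norm_nonneg _) (planeCutoff_le_one s ε x)
  · filter_upwards [ae_restrict_of_ae (ae_planeDist_ne_zero hs1)] with x hx
    refine tendsto_const_nhds.congr' ?_
    have : ∀ᶠ ε : ℝ in 𝓝[>] 0, ∀ h ∈ s, evenCutoff (planeDist h x / ε) = 1 := by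
      rw [Filter.eventually_all_finset]
      intro h hh
      have hpos : 0 < |planeDist h x| := abs_pos.2 (hx h hh)
      filter_upwards [Ioo_mem_nhdsGT (half_pos hpos)] with ε hε
      exact evenCutoff_div_eq_one hpos le_rfl hε.1 hε.2
    filter_upwards [this] with ε hε
    rw [planeCutoff, Finset.prod_eq_one hε, one_mul]

end KForm

/-! ### Vanishing of the flux and of the integrated defect -/

namespace Polytopes

open KForm

variable {n k : ℕ} {Ω : Set (EuclideanSpace ℝ (Fin n))}

/-- The covering hyperplanes are not oriented, so the outward normal may be `a` or `-a`; both
boundary conditions are linear in the normal and do not see the sign. -/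
theorem flux_eq_zero {ω : EuclideanSpace ℝ (Fin n) → KForm n (k + 1)}
    {D : EuclideanSpace ℝ (Fin n) → EuclideanSpace ℝ (Fin n) →L[ℝ] KForm n (k + 1)}
    (hω : ContinuousOn ω (closure Ω)) (hD : ContinuousOn D (closure Ω))
    (hωD : ∀ x ∈ Ω, HasFDerivAt ω (D x) x)
    (hbd : TangentialPartVanishes Ω ω ∨ NormalPartVanishes Ω ω)
    {a y ν : EuclideanSpace ℝ (Fin n)} (ha : ‖a‖ = 1) (hν : ν = a ∨ ν = -a)
    (hy : IsOutwardUnitNormal Ω y ν) : flux a (ω y) (D y) = 0 := by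
  have hperp : ∀ t, inner ℝ a t = 0 → inner ℝ ν t = 0 := by
    intro t ht
    rcases hν with rfl | rfl
    · exact ht
    · rw [inner_neg_left, ht, neg_zero]
  rcases hbd with hbd | hbd
  · have hT : ∀ z, IsOutwardUnitNormal Ω z ν → wedgeL a (ω z) = 0 := by
      intro z hz
      have := hbd z hz.mem_frontier ν hz
      rcases hν with rfl | rfl
      · exact this
      · rw [wedge_neg] at this
        exact neg_eq_zero.1 this
    exact flux_eq_zero_of_tangential ha (hT y hy) fun t ht =>
      map_tangential_deriv_eq_zero hω hD hωD (wedgeL a) hy hT (hperp t ht)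
  · have hT : ∀ z, IsOutwardUnitNormal Ω z ν → contractL a (ω z) = 0 := by
      intro z hz
      have : (ω z).curryLeft ν = 0 := hbd z hz.mem_frontier ν hz
      rcases hν with rfl | rfl
      · exact this
      · rw [map_neg] at this
        exact neg_eq_zero.1 this
    exact flux_eq_zero_of_normal ha (hT y hy) fun t ht =>
      map_tangential_deriv_eq_zero hω hD hωD (contractL a) hy hT (hperp t ht)

theorem setIntegral_gaffneyDefect_eq_zero (hΩ : IsGeneralizedPolytope Ω)
    {ω : EuclideanSpace ℝ (Fin n) → KForm n (k + 1)}
    {D : EuclideanSpace ℝ (Fin n) → EuclideanSpace ℝ (Fin n) →L[ℝ] KForm n (k + 1)}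
    (hω : ContinuousOn ω (closure Ω)) (hD : ContinuousOn D (closure Ω))
    (hωD : ∀ x ∈ Ω, HasFDerivAt ω (D x) x)
    (hbd : TangentialPartVanishes Ω ω ∨ NormalPartVanishes Ω ω) :
    ∫ x in Ω, gaffneyDefect (D x) = 0 := by
  have ho := hΩ.isOpen
  have hb := hΩ.isBounded
  obtain ⟨s, hs1, hs2, hs⟩ := hΩ.coveredByPlanes_frontier.exists_distinct
  have hQ := continuousOn_gaffneyDefect hD
  have hlim1 := tendsto_setIntegral_planeCutoff_mul hb hs1 hQ
  have hlim2 : Tendsto (fun ε => -∑ h ∈ s, ∫ x in Ω,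
      planeCutoffCoeff s ε h x * flux h.1 (ω x) (D x)) (𝓝[>] 0) (𝓝 0) := by
    have : Tendsto (fun ε => ∑ h ∈ s, ∫ x in Ω,
        planeCutoffCoeff s ε h x * flux h.1 (ω x) (D x)) (𝓝[>] 0) (𝓝 (∑ h ∈ s, 0)) :=
      tendsto_finsetSum _ fun h hh =>
        tendsto_setIntegral_planeCutoffCoeff_mul ho hb hs1 hs2 hs hh (continuousOn_flux h.1 hω hD)
          fun y ν hν hy => flux_eq_zero hω hD hωD hbd (hs1 h hh) hν hy
    simpa using this.neg
  refine tendsto_nhds_unique (hlim1.congr' ?_) hlim2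
  filter_upwards [self_mem_nhdsWithin] with ε hε
  have key := setIntegral_planeCutoff_gaffneyDefect ho hb hs hω hD hωD hε
  have i1 : IntegrableOn (fun x => planeCutoff s ε x * gaffneyDefect (D x)) Ω :=
    ContinuousOn.integrableOn_of_isBounded hb ((continuous_planeCutoff s ε).continuousOn.mul hQ)
  have i2 : ∀ h ∈ s, IntegrableOn
      (fun x => planeCutoffCoeff s ε h x * flux h.1 (ω x) (D x)) Ω := fun h _ =>
    ContinuousOn.integrableOn_of_isBounded hb
      ((continuous_planeCutoffCoeff s ε h).continuousOn.mul (continuousOn_flux h.1 hω hD))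
  rw [integral_add i1 (integrable_finsetSum _ i2), integral_finsetSum _ i2] at key
  linarith

end Polytopes

end

theorem theorem6p2 (n k : ℕ) (Ω : Set (EuclideanSpace ℝ (Fin n)))
    (hΩ : Polytopes.IsGeneralizedPolytope Ω)
    (ω : EuclideanSpace ℝ (Fin n) → KForm n k)
    (hω : KForm.IsC1UpToBoundary Ω ω)
    (hbd : Polytopes.TangentialPartVanishes Ω ω ∨ Polytopes.NormalPartVanishes Ω ω) :
    (IntegrableOn (fun x => KForm.gradNormSq ω x) Ω ∧
      IntegrableOn (fun x => KForm.normSq (extDeriv ω x)) Ω ∧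
      IntegrableOn (fun x => KForm.normSq (KForm.codiff ω x)) Ω) ∧
    (∫ x in Ω, KForm.gradNormSq ω x) =
      (∫ x in Ω, KForm.normSq (extDeriv ω x)) + (∫ x in Ω, KForm.normSq (KForm.codiff ω x)) := by
  obtain ⟨hωc, D, hD, hωD⟩ := hω
  have hm := hΩ.isOpen.measurableSet
  have hb := hΩ.isBounded
  have e1 : Set.EqOn (fun x => KForm.gradNormSq ω x)
      (fun x => ∑ j, (D x (KForm.basisVec j)).normSq) Ω := fun x hx => by
    simp only [KForm.gradNormSq, KForm.partialDeriv, (hωD x hx).fderiv]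
  have e2 : Set.EqOn (fun x => KForm.normSq (extDeriv ω x))
      (fun x => KForm.normSq (ContinuousAlternatingMap.alternatizeUncurryFin (D x))) Ω :=
    fun x hx => by simp only [extDeriv, (hωD x hx).fderiv]
  have e3 : Set.EqOn (fun x => KForm.normSq (KForm.codiff ω x))
      (fun x => KForm.normSq (∑ j, KForm.interiorProd (KForm.basisVec j)
        (D x (KForm.basisVec j)))) Ω := fun x hx => by
    simp only [KForm.codiff, KForm.partialDeriv, (hωD x hx).fderiv]
  have i1 : IntegrableOn (fun x => ∑ j, (D x (KForm.basisVec j)).normSq) Ω :=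
    ContinuousOn.integrableOn_of_isBounded hb (continuousOn_finsetSum _ fun j _ =>
      KForm.continuous_normSq.comp_continuousOn (hD.clm_apply continuousOn_const))
  have i2 : IntegrableOn
      (fun x => KForm.normSq (ContinuousAlternatingMap.alternatizeUncurryFin (D x))) Ω :=
    ContinuousOn.integrableOn_of_isBounded hb (KForm.continuous_normSq.comp_continuousOn
      ((ContinuousAlternatingMap.alternatizeUncurryFinCLM ℝ (EuclideanSpace ℝ (Fin n))
        ℝ).continuous.comp_continuousOn hD))
  have i3 : IntegrableOn (fun x => KForm.normSq (∑ j, KForm.interiorProd (KForm.basisVec j)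
        (D x (KForm.basisVec j)))) Ω :=
    ContinuousOn.integrableOn_of_isBounded hb
      (KForm.continuous_normSq.comp_continuousOn (KForm.continuousOn_sum_interiorProd hD))
  refine ⟨⟨i1.congr_fun e1.symm hm, i2.congr_fun e2.symm hm, i3.congr_fun e3.symm hm⟩, ?_⟩
  rw [setIntegral_congr_fun hm e1, setIntegral_congr_fun hm e2, setIntegral_congr_fun hm e3,
    ← integral_add i2 i3]
  cases k with
  -- For functions `δω = 0` and `|dω|² = |∇ω|²` pointwise; the boundary condition plays no role.
  | zero =>
    refine integral_congr_ae (Filter.Eventually.of_forall fun x => ?_)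
    simp only [KForm.normSq_alternatizeUncurryFin_zero]
    simp [KForm.interiorProd, KForm.normSq, KForm.component]
  | succ k =>
    have h0 := Polytopes.setIntegral_gaffneyDefect_eq_zero hΩ hωc hD hωD hbd
    have hpoint : ∀ x, KForm.normSq (ContinuousAlternatingMap.alternatizeUncurryFin (D x)) +
        KForm.normSq (∑ j, KForm.interiorProd (KForm.basisVec j) (D x (KForm.basisVec j))) =
        ∑ j, (D x (KForm.basisVec j)).normSq + KForm.gaffneyDefect (D x) := fun x =>
      KForm.normSq_alternatizeUncurryFin_add (D x)
    simp only [hpoint]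
    rw [integral_add i1 (ContinuousOn.integrableOn_of_isBounded hb
      (KForm.continuousOn_gaffneyDefect hD)), h0, add_zero]
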